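/- Let $r \ge 1$ and $0 \le p < n$ be integers, let $x^{(1)},\dots,x^{(n)}$ be distinct points of a set $\mathcal D \subset \mathbb R^r$, and let $f_1,\dots,f_p : \mathcal D \to \mathbb R$ be functions such that the $n\times p$ matrix $H = (f_j(x^{(i)}))_{i,j}$ has rank $p$. Let $W$ be an $n\times(n-p)$ real matrix with $W^\top W = I_{n-p}$ and $H^\top W = 0$ (if $p=0$, every condition on $H$ is void). Let $K:[0,\infty)\to\mathbb R$ be one of the following kernels: - the Squared Exponential kernel $K(d)=e^{-d^2}$; - a Rational Quadratic kernel $K(d) = (1+d^2)^{-\nu}$ with $\nu>0$; - a Matérn kernel $K(d) = \Gamma(\nu)^{-1}2^{1-\nu}(2\sqrt\nu\, d)^\nu \mathcal K_\nu(2\sqrt\nu\, d)$ for $d>0$, $K(0)=1$, with $\nu\ge 1$, where $\mathcal K_\nu(z)=\int_0^\infty e^{-z\cosh t}\cosh(\nu t)\,dt$ is the modified Bessel function of the second kind. For $\theta>0$ let $\Sigma_\theta$ be the $n\times n$ matrix with entries $K(\|x^{(i)}-x^{(j)}\|/\theta)$, and let $v_1(\theta)\ge\dots\ge v_{n-p}(\theta)$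 be the eigenvalues of $W^\top\Sigma_\theta W$. For $y\in\mathbb R^n$ define the integrated likelihood $$L(y\mid\theta)=\int_0^\infty\!\int_{\mathbb R^p} \Big(\frac1{2\pi\sigma^2}\Big)^{n/2}|\Sigma_\theta|^{-1/2}\exp\Big\{-\frac1{2\sigma^2}(y-H\beta)^\top\Sigma_\theta^{-1}(y-H\beta)\Big\}\,\frac{1}{\sigma^2}\,d\beta\,d\sigma^2\in[0,\infty]$$ (with no integral over $\beta$ and no term $H\beta$ if $p=0$). Then there is a hyperplane (linear subspace of dimension $n-1$) $\mathcal H$ of $\mathbb R^n$ such that for every $y\in\mathbb R^n\setminus\mathcal H$: 1. $y^\top W(W^\top\Sigma_\theta W)^{-1}W^\top y>0$ for every $\theta>0$, and $$\big(y^\top W(W^\top\Sigma_\theta W)^{-1}W^\top y\big)^{-1}=O(v_{n-p}(\theta))\quad\text{as }\theta\to+\infty;$$ 2. $L(y\mid\theta)<\infty$ for every $\theta>0$, and $$L(y\mid\theta)^2=O\Big(\prod_{i=1}^{n-p}\frac{v_{n-p}(\theta)}{v_i(\theta)}\Big)\quad\text{and}\quad L(y\mid\theta)=O(1)\quad\text{as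 }\theta\to+\infty.$$ -/

import Mathlib

open Matrix MeasureTheory Filter Asymptotics

noncomputable section

/-- The modified Bessel function of the second kind of order `ν`, for arguments `z > 0`:
`𝒦_ν(z) = ∫_0^∞ exp(-z cosh t) cosh(ν t) dt`. -/
def besselK (ν z : ℝ) : ℝ :=
  ∫ t in Set.Ioi (0 : ℝ), Real.exp (-(z * Real.cosh t)) * Real.cosh (ν * t)

/-- Squared Exponential correlation kernel `exp(-d²)`. -/
def squaredExponentialKernel (d : ℝ) : ℝ := Real.exp (-d ^ 2)

/-- Rational Quadratic correlation kernel `(1 + d²)^(-ν)`. -/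
def rationalQuadraticKernel (ν d : ℝ) : ℝ := (1 + d ^ 2) ^ (-ν)

/-- Matérn correlation kernel
`Γ(ν)⁻¹ 2^(1-ν) (2√ν d)^ν 𝒦_ν(2√ν d)` for `d > 0`, with its limit value `1` at `d = 0`. -/
def maternKernel (ν d : ℝ) : ℝ :=
  if d = 0 then 1
  else (Real.Gamma ν)⁻¹ * 2 ^ (1 - ν) * (2 * √ν * d) ^ ν * besselK ν (2 * √ν * d)

/-- The correlation matrix `Σ_θ`, with entries `K_θ(‖x_i - x_j‖) = K(‖x_i - x_j‖ / θ)`. -/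
def corrMatrix {r n : ℕ} (K : ℝ → ℝ) (x : Fin n → EuclideanSpace ℝ (Fin r)) (θ : ℝ) :
    Matrix (Fin n) (Fin n) ℝ :=
  Matrix.of fun i j => K (‖x i - x j‖ / θ)

/-- The matrix `H` with entries `f_j(x_i)`. -/
def trendMatrix {X : Type*} {n p : ℕ} (f : Fin p → X → ℝ) (x : Fin n → X) :
    Matrix (Fin n) (Fin p) ℝ :=
  Matrix.of fun i j => f j (x i)

/-- The matrix `Wᵀ Σ_θ W`. -/
def projCorrMatrix {r n m : ℕ} (K : ℝ → ℝ) (x : Fin n → EuclideanSpace ℝ (Fin r))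
    (W : Matrix (Fin n) (Fin m) ℝ) (θ : ℝ) : Matrix (Fin m) (Fin m) ℝ :=
  Wᵀ * corrMatrix K x θ * W

theorem projCorrMatrix_isHermitian {r n m : ℕ} (K : ℝ → ℝ)
    (x : Fin n → EuclideanSpace ℝ (Fin r)) (W : Matrix (Fin n) (Fin m) ℝ) (θ : ℝ) :
    (projCorrMatrix K x W θ).IsHermitian := by
  have h : (corrMatrix K x θ)ᵀ = corrMatrix K x θ := by
    ext i j
    simp [corrMatrix, norm_sub_rev]
  simp [Matrix.IsHermitian, projCorrMatrix, Matrix.conjTranspose_eq_transpose_of_trivial,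
    Matrix.transpose_mul, h, Matrix.mul_assoc]

/-- The eigenvalues of `Wᵀ Σ_θ W`, listed with multiplicity (in no particular order). -/
def projCorrEigenvalues {r n m : ℕ} (K : ℝ → ℝ) (x : Fin n → EuclideanSpace ℝ (Fin r))
    (W : Matrix (Fin n) (Fin m) ℝ) (θ : ℝ) : Fin m → ℝ :=
  (projCorrMatrix_isHermitian K x W θ).eigenvalues

/-- The smallest eigenvalue of `Wᵀ Σ_θ W` (for `m > 0`). -/
def projCorrMinEigenvalue {r n m : ℕ} (K : ℝ → ℝ) (x : Fin n → EuclideanSpace ℝ (Fin r))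
    (W : Matrix (Fin n) (Fin m) ℝ) (θ : ℝ) : ℝ :=
  ⨅ i, projCorrEigenvalues K x W θ i

/-- The quadratic form `yᵀ W (Wᵀ Σ_θ W)⁻¹ Wᵀ y`. -/
def projQuadForm {r n m : ℕ} (K : ℝ → ℝ) (x : Fin n → EuclideanSpace ℝ (Fin r))
    (W : Matrix (Fin n) (Fin m) ℝ) (y : Fin n → ℝ) (θ : ℝ) : ℝ :=
  (Wᵀ *ᵥ y) ⬝ᵥ ((projCorrMatrix K x W θ)⁻¹ *ᵥ (Wᵀ *ᵥ y))

/-- The Gaussian likelihood `L(y | β, σ², θ)`; the variable `s` stands for `σ²`, `S` for the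
correlation matrix `Σ_θ` and `H` for the matrix of the mean functions. -/
def gaussianLikelihood {n p : ℕ} (S : Matrix (Fin n) (Fin n) ℝ) (H : Matrix (Fin n) (Fin p) ℝ)
    (y : Fin n → ℝ) (β : Fin p → ℝ) (s : ℝ) : ℝ :=
  (1 / (2 * Real.pi * s)) ^ ((n : ℝ) / 2) * S.det ^ (-(1 / 2) : ℝ) *
    Real.exp (-(1 / (2 * s)) * ((y - H *ᵥ β) ⬝ᵥ (S⁻¹ *ᵥ (y - H *ᵥ β))))

/-- The integrated likelihood `L(y | θ) = ∬ L(y | β, σ², θ) / σ² dβ dσ²`, the integral over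
`β ∈ ℝ^p` and `σ² ∈ (0, ∞)` of a nonnegative function, with values in `[0, ∞]`.
For `p = 0` the integral over `β` is evaluation at the only point of `ℝ^0`. -/
def integratedLikelihood {n p : ℕ} (S : Matrix (Fin n) (Fin n) ℝ) (H : Matrix (Fin n) (Fin p) ℝ)
    (y : Fin n → ℝ) : ENNReal :=
  ∫⁻ s in Set.Ioi (0 : ℝ), ∫⁻ β : Fin p → ℝ, ENNReal.ofReal (gaussianLikelihood S H y β s / s)

end

/-! Put `M θ = Wᵀ Σ_θ W` and `m = n - p`. Everything rests on one fact: `M⁻¹ / tr M⁻¹` converges as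
`θ → ∞` to a matrix `A`, which is positive semidefinite of trace one, hence nonzero. If `Wᵀ y` is
not orthogonal to a fixed nonzero vector of the range of `A`, then `Q = yᵀ W M⁻¹ Wᵀ y` is eventually
at least a positive multiple of `tr M⁻¹`, which is at least the inverse of the smallest eigenvalue.
The excluded `y` form the hyperplane (`exists_hyperplane_inv_projQuadForm_le`).

Convergence (`exists_tendsto_inv_div_trace`) has two ingredients. With `θ = eˣ`, every kernel entry
can be approximated to any order `e^{-Nx}` by finite sums of terms `e^{αx} xʲ`. Such functions form
an algebra, so adjugate entries belong to it, and a bounded quotient of two of them converges once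
the denominator is not smaller than every `e^{-Nx}`. The denominator here is `tr adj M`. Its lower
bound comes from writing each kernel as a mixture of Gaussian kernels: the Gaussian determinant is
analytic in the inverse length scale and positive away from zero, so it decays only polynomially.

For the Matérn kernel the expansion comes from an integral `I_a(x)` with `I_a' = e^{-x} I_{a-1}` and
`I_{-a} = e^{ax} I_a`. Alternating integration and reflection improves the remainder indefinitely.

For the likelihood, completing the square and integrating out `β` and then `σ²` gives `L = C (det
M)^{-1/2} Q^{-m/2}` (`exists_integratedLikelihood_eq`). The bound on `Q⁻¹` then yields the bound on
`L²`, and each ratio of the smallest eigenvalue to another is at most one. -/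

/-! ### Gaussian kernel matrices: positivity and decay of the determinant. -/

section GaussianKernel

variable {E : Type*} [NormedAddCommGroup E] {ι : Type*}

/-- The matrix of the Gaussian kernel with inverse length scale `δ`. -/
noncomputable def gaussianMatrix (x : ι → E) (δ : ℝ) : Matrix ι ι ℝ :=
  Matrix.of fun i j => Real.exp (-(δ * ‖x i - x j‖) ^ 2)

variable [Fintype ι]

theorem analyticAt_det_gaussianMatrix [DecidableEq ι] (x : ι → E) :
    AnalyticAt ℝ (fun δ => (gaussianMatrix x δ).det) 0 := by
  simp only [Matrix.det_apply, gaussianMatrix, Matrix.of_apply, Units.smul_def, zsmul_eq_mul]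
  fun_prop

variable [InnerProductSpace ℝ E]

theorem dotProduct_mulVec_eq_sum {m : Type*} [Fintype m] (A : Matrix m m ℝ) (z : m → ℝ) :
    z ⬝ᵥ (A *ᵥ z) = ∑ i, ∑ j, z i * z j * A i j := by
  simp only [dotProduct, mulVec, Finset.mul_sum]
  exact Finset.sum_congr rfl fun i _ => Finset.sum_congr rfl fun j _ => by ring

/-- Schur product theorem, starting from the rank-one all-ones matrix. -/
theorem posSemidef_of_inner_pow (x : ι → E) (k : ℕ) :
    (Matrix.of fun i j => (inner ℝ (x i) (x j)) ^ k : Matrix ι ι ℝ).PosSemidef := by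
  induction k with
  | zero =>
    have h : (Matrix.of fun i j => (inner ℝ (x i) (x j)) ^ 0 : Matrix ι ι ℝ)
        = vecMulVec (fun _ => 1) (star fun _ => 1) := by
      ext i j; simp [vecMulVec]
    rw [h]
    exact posSemidef_vecMulVec_self_star _
  | succ k ih =>
    have h := ih.hadamard (posSemidef_gram ℝ x)
    have heq : (Matrix.of fun i j => (inner ℝ (x i) (x j)) ^ (k + 1) : Matrix ι ι ℝ)
        = (Matrix.of fun i j => (inner ℝ (x i) (x j)) ^ k) ⊙ gram ℝ x := by
      ext i j; simp [pow_succ]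
    rw [heq]
    exact h

theorem posSemidef_of_exp_inner (x : ι → E) :
    (Matrix.of fun i j => Real.exp (inner ℝ (x i) (x j)) : Matrix ι ι ℝ).PosSemidef := by
  refine PosSemidef.of_dotProduct_mulVec_nonneg ?_ fun z => ?_
  · ext i j
    simp [real_inner_comm]
  · rw [star_trivial, dotProduct_mulVec_eq_sum]
    have hs : HasSum (fun k : ℕ => ∑ i, ∑ j, z i * z j * (inner ℝ (x i) (x j) ^ k / k.factorial))
        (∑ i, ∑ j, z i * z j * Real.exp (inner ℝ (x i) (x j))) := by
      refine hasSum_sum fun i _ => hasSum_sum fun j _ => HasSum.mul_left _ ?_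
      rw [Real.exp_eq_exp_ℝ]
      exact NormedSpace.expSeries_div_hasSum_exp _
    refine hs.nonneg fun k => ?_
    have := (posSemidef_of_inner_pow x k).dotProduct_mulVec_nonneg z
    rw [star_trivial, dotProduct_mulVec_eq_sum] at this
    have h2 := div_nonneg this (Nat.cast_nonneg (α := ℝ) k.factorial)
    simp only [Finset.sum_div, Matrix.of_apply] at h2
    simpa only [mul_div_assoc] using h2

/-- The multiplicative character `t ↦ exp ⟪v, t⟫`. -/
noncomputable def expInnerHom (v : E) : Multiplicative E →* ℝ where
  toFun t := Real.exp (inner ℝ v t.toAdd)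
  map_one' := by simp
  map_mul' s t := by simp [inner_add_right, Real.exp_add]

theorem expInnerHom_injective : Function.Injective (expInnerHom : E → Multiplicative E →* ℝ) := by
  intro v w h
  refine ext_inner_right ℝ fun t => ?_
  have := DFunLike.congr_fun h (Multiplicative.ofAdd t)
  simpa [expInnerHom] using this

/-- A null vector `z` of the form would satisfy `∑ zᵢ exp ⟪xᵢ, t⟫ = 0` for every `t`, whereas
distinct characters are linearly independent (Dedekind). -/
theorem posDef_of_exp_inner (x : ι → E) (hx : Function.Injective x) :
    (Matrix.of fun i j => Real.exp (inner ℝ (x i) (x j)) : Matrix ι ι ℝ).PosDef := by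
  classical
  have hps := posSemidef_of_exp_inner x
  refine PosDef.of_dotProduct_mulVec_pos hps.1 fun z hz => ?_
  refine lt_of_le_of_ne (hps.dotProduct_mulVec_nonneg z) fun h0 => hz ?_
  have hlin : LinearIndependent ℝ fun i => (expInnerHom (x i) : Multiplicative E → ℝ) :=
    (linearIndependent_monoidHom (Multiplicative E) ℝ).comp _ (expInnerHom_injective.comp hx)
  rw [Fintype.linearIndependent_iff] at hlin
  refine funext (hlin z ?_)
  ext t
  -- Adjoin `t` as an extra point of weight zero. The form is unchanged, so the extended vector lies
  -- in the kernel of a larger semidefinite matrix, and the row of `t` is the desired relation.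
  let y : Option ι → E := fun o => o.elim t.toAdd x
  have hy := posSemidef_of_exp_inner y
  let w : Option ι → ℝ := fun o => o.elim 0 z
  have hw : star w ⬝ᵥ ((Matrix.of fun i j => Real.exp (inner ℝ (y i) (y j))) *ᵥ w) = 0 := by
    rw [star_trivial, dotProduct_mulVec_eq_sum] at h0 ⊢
    simpa [Fintype.sum_option, w, y] using h0.symm
  rw [hy.dotProduct_mulVec_zero_iff] at hw
  have := congrFun hw none
  simpa [mulVec, dotProduct, Fintype.sum_option, w, y, expInnerHom, real_inner_comm,
    mul_comm] using this

theorem posDef_gaussianMatrix (x : ι → E) (hx : Function.Injective x) {δ : ℝ} (hδ : 0 < δ) :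
    (gaussianMatrix x δ).PosDef := by
  classical
  -- Expanding the square of the norm leaves the cross term `2 δ² ⟪xᵢ, xⱼ⟫`, absorbed by scaling the
  -- points by `√2 δ`; the rest is an invertible diagonal congruence.
  have hc : 0 < √2 * δ := by positivity
  have h := posDef_of_exp_inner (fun i => (√2 * δ) • x i)
    ((smul_right_injective E hc.ne').comp hx)
  have heq : gaussianMatrix x δ =
      (diagonal fun i => Real.exp (-(δ * ‖x i‖) ^ 2))ᴴ *
        (Matrix.of fun i j => Real.exp (inner ℝ ((√2 * δ) • x i) ((√2 * δ) • x j))) *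
        (diagonal fun i => Real.exp (-(δ * ‖x i‖) ^ 2)) := by
    ext i j
    simp only [gaussianMatrix, diagonal_conjTranspose, star_trivial, mul_diagonal, diagonal_mul,
      Matrix.of_apply, inner_smul_left, inner_smul_right, ← Real.exp_add]
    congr 1
    have h1 := norm_sub_sq_real (x i) (x j)
    have h2 : √2 ^ 2 = (2 : ℝ) := Real.sq_sqrt (by norm_num)
    simp only [conj_trivial]
    linear_combination -δ ^ 2 * h1 - δ ^ 2 * (inner ℝ (x i) (x j)) * h2
  rw [heq]
  refine h.conjTranspose_mul_mul_same fun u v huv => ?_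
  ext i
  have := congrFun huv i
  simpa [mulVec_diagonal] using this

/-- The determinant is analytic at `0` and positive for `δ > 0`, so it has a finite order of
vanishing `N` there. -/
theorem exists_le_det_gaussianMatrix [DecidableEq ι] (x : ι → E) (hx : Function.Injective x) :
    ∃ c : ℝ, 0 < c ∧ ∃ N : ℕ, ∃ δ₀ : ℝ, 0 < δ₀ ∧
      ∀ δ, 0 < δ → δ < δ₀ → c * δ ^ N ≤ (gaussianMatrix x δ).det := by
  have ha := analyticAt_det_gaussianMatrix x
  have hpos : ∀ δ > 0, 0 < (gaussianMatrix x δ).det := fun δ hδ =>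
    (posDef_gaussianMatrix x hx hδ).det_pos
  have hne : ¬ ∀ᶠ δ in nhds (0 : ℝ), (gaussianMatrix x δ).det = 0 := by
    intro h
    have h1 := (h.filter_mono (nhdsWithin_le_nhds (s := Set.Ioi 0))).and self_mem_nhdsWithin
    obtain ⟨δ, h2, h3⟩ := h1.exists
    exact (hpos δ h3).ne' h2
  obtain ⟨N, g, hg, hg0, hgN⟩ := (ha.exists_eventuallyEq_pow_smul_nonzero_iff).2 hne
  have hc : ∀ᶠ δ in nhds (0 : ℝ), |g 0| / 2 < |g δ| :=
    (hg.continuousAt.abs).eventually_const_lt (by have := abs_pos.2 hg0; linarith)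
  obtain ⟨δ₀, hδ₀, hb⟩ := Metric.eventually_nhds_iff.1 (hc.and hgN)
  refine ⟨|g 0| / 2, by have := abs_pos.2 hg0; linarith, N, δ₀, hδ₀, fun δ h0 h1 => ?_⟩
  obtain ⟨h2, h3⟩ := hb (y := δ) (by simpa [abs_of_pos h0] using h1)
  rw [← abs_of_pos (hpos δ h0), h3]
  simp only [sub_zero, smul_eq_mul, abs_mul, abs_pow, abs_of_pos h0]
  rw [mul_comm]
  gcongr

end GaussianKernel

/-! ### Quadratic forms and eigenvalue bounds. -/

section QuadraticForms

variable {m : Type*} [Fintype m] [DecidableEq m] {A : Matrix m m ℝ}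

/-- The coordinates of `z` in the eigenbasis of a symmetric matrix. -/
noncomputable def eigenCoord (hA : A.IsHermitian) (z : m → ℝ) : m → ℝ :=
  (star (hA.eigenvectorUnitary : Matrix m m ℝ)) *ᵥ z

theorem sum_sq_eigenCoord (hA : A.IsHermitian) (z : m → ℝ) :
    ∑ i, eigenCoord hA z i ^ 2 = z ⬝ᵥ z := by
  have h : eigenCoord hA z ⬝ᵥ eigenCoord hA z = z ⬝ᵥ z := by
    rw [eigenCoord, dotProduct_mulVec, vecMul_mulVec, ← dotProduct_mulVec]
    rw [star_eq_conjTranspose, conjTranspose_eq_transpose_of_trivial, transpose_transpose,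
      ← conjTranspose_eq_transpose_of_trivial, ← star_eq_conjTranspose,
      Unitary.mul_star_self_of_mem hA.eigenvectorUnitary.2,
      one_mulVec]
  rw [← h]
  exact Finset.sum_congr rfl fun i _ => sq _

theorem dotProduct_mulVec_eq_sum_eigenvalues (hA : A.IsHermitian) (z : m → ℝ) :
    z ⬝ᵥ (A *ᵥ z) = ∑ i, hA.eigenvalues i * eigenCoord hA z i ^ 2 := by
  have hs : A = (hA.eigenvectorUnitary : Matrix m m ℝ) * diagonal hA.eigenvalues *
      star (hA.eigenvectorUnitary : Matrix m m ℝ) := by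
    conv_lhs => rw [hA.spectral_theorem]
    simp [Unitary.conjStarAlgAut_apply]
  have h : z ⬝ᵥ (A *ᵥ z) = eigenCoord hA z ⬝ᵥ (diagonal hA.eigenvalues *ᵥ eigenCoord hA z) := by
    conv_lhs => rw [hs]
    rw [← mulVec_mulVec, ← mulVec_mulVec, dotProduct_mulVec, ← mulVec_transpose]
    rfl
  rw [h, dotProduct]
  refine Finset.sum_congr rfl fun i _ => ?_
  rw [mulVec_diagonal]
  ring

theorem mul_dotProduct_self_le_of_le_eigenvalues (hA : A.IsHermitian) {c : ℝ}
    (hc : ∀ i, c ≤ hA.eigenvalues i) (z : m → ℝ) : c * (z ⬝ᵥ z) ≤ z ⬝ᵥ (A *ᵥ z) := by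
  rw [dotProduct_mulVec_eq_sum_eigenvalues hA, ← sum_sq_eigenCoord hA, Finset.mul_sum]
  gcongr with i
  exact hc i

theorem le_eigenvalues_of_mul_dotProduct_self_le (hA : A.IsHermitian) {c : ℝ}
    (hc : ∀ z : m → ℝ, c * (z ⬝ᵥ z) ≤ z ⬝ᵥ (A *ᵥ z)) (i : m) : c ≤ hA.eigenvalues i := by
  have h := hc (hA.eigenvectorBasis i).ofLp
  rw [hA.mulVec_eigenvectorBasis] at h
  have h1 : (hA.eigenvectorBasis i).ofLp ⬝ᵥ (hA.eigenvectorBasis i).ofLp = 1 := by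
    have := hA.eigenvectorBasis.orthonormal.1 i
    have h2 := EuclideanSpace.real_norm_sq_eq (hA.eigenvectorBasis i)
    rw [this] at h2
    simp only [dotProduct, ← sq]
    linarith
  simpa [dotProduct_smul, h1] using h

theorem Matrix.PosDef.eigenvalues_le_trace (hA : A.PosDef) (i : m) :
    hA.isHermitian.eigenvalues i ≤ A.trace := by
  have h := hA.isHermitian.trace_eq_sum_eigenvalues
  simp only [RCLike.ofReal_real_eq_id, id] at h
  rw [h]
  exact Finset.single_le_sum (fun j _ => (hA.eigenvalues_pos j).le) (Finset.mem_univ i)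

/-- The other `card m - 1` factors of the determinant are each at most `T`. -/
theorem Matrix.PosDef.det_div_le_eigenvalues (hA : A.PosDef) {T : ℝ} (hT : A.trace ≤ T) (i : m) :
    A.det / T ^ (Fintype.card m - 1) ≤ hA.isHermitian.eigenvalues i := by
  have hT0 : 0 < T := ((hA.eigenvalues_pos i).trans_le (hA.eigenvalues_le_trace i)).trans_le hT
  rw [div_le_iff₀ (by positivity)]
  have h := hA.isHermitian.det_eq_prod_eigenvalues
  simp only [RCLike.ofReal_real_eq_id, id] at h
  rw [h, ← Finset.mul_prod_erase _ _ (Finset.mem_univ i)]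
  refine mul_le_mul_of_nonneg_left ?_ (hA.eigenvalues_pos i).le
  calc _ ≤ ∏ _j ∈ Finset.univ.erase i, T := Finset.prod_le_prod
        (fun j _ => (hA.eigenvalues_pos j).le)
        fun j _ => (hA.eigenvalues_le_trace j).trans hT
    _ = _ := by simp [Finset.card_erase_of_mem, Finset.card_univ]

end QuadraticForms

/-! ### Mixtures of Gaussian kernels. -/

section Mixture

/-- `K` is a mixture of Gaussian kernels with positive inverse length scales. -/
def IsGaussianMixture (K : ℝ → ℝ) : Prop :=
  ∃ (μ : Measure ℝ) (h : ℝ → ℝ), IsProbabilityMeasure μ ∧ Measurable h ∧ (∀ᵐ t ∂μ, 0 < h t) ∧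
    ∀ d, 0 ≤ d → K d = ∫ t, Real.exp (-(h t * d) ^ 2) ∂μ

variable {r n : ℕ} {K : ℝ → ℝ} {x : Fin n → EuclideanSpace ℝ (Fin r)}

theorem corrMatrix_isHermitian (K : ℝ → ℝ) (x : Fin n → EuclideanSpace ℝ (Fin r)) (θ : ℝ) :
    (corrMatrix K x θ).IsHermitian := by
  ext i j
  simp [corrMatrix, norm_sub_rev]

theorem integrable_exp_neg_sq {μ : Measure ℝ} [IsProbabilityMeasure μ] {h : ℝ → ℝ}
    (hh : Measurable h) (d : ℝ) : Integrable (fun t => Real.exp (-(h t * d) ^ 2)) μ := by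
  refine Integrable.of_bound (C := 1) (by fun_prop) (ae_of_all _ fun t => ?_)
  rw [Real.norm_eq_abs, Real.abs_exp, Real.exp_le_one_iff]
  nlinarith [sq_nonneg (h t * d)]

theorem integrable_quadForm_gaussianMatrix {μ : Measure ℝ} [IsProbabilityMeasure μ] {h : ℝ → ℝ}
    (hh : Measurable h) (x : Fin n → EuclideanSpace ℝ (Fin r)) (θ : ℝ) (z : Fin n → ℝ) :
    Integrable (fun t => z ⬝ᵥ (gaussianMatrix x (h t / θ) *ᵥ z)) μ := by
  simp only [dotProduct_mulVec_eq_sum, gaussianMatrix, Matrix.of_apply]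
  refine integrable_finsetSum _ fun i _ => integrable_finsetSum _ fun j _ => ?_
  simp only [div_mul_eq_mul_div, mul_div_assoc]
  exact (integrable_exp_neg_sq hh _).const_mul _

theorem quadForm_corrMatrix_eq_integral {μ : Measure ℝ} [IsProbabilityMeasure μ] {h : ℝ → ℝ}
    (hh : Measurable h) (hK : ∀ d, 0 ≤ d → K d = ∫ t, Real.exp (-(h t * d) ^ 2) ∂μ)
    (x : Fin n → EuclideanSpace ℝ (Fin r)) {θ : ℝ} (hθ : 0 < θ) (z : Fin n → ℝ) :
    z ⬝ᵥ (corrMatrix K x θ *ᵥ z) = ∫ t, z ⬝ᵥ (gaussianMatrix x (h t / θ) *ᵥ z) ∂μ := by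
  simp only [dotProduct_mulVec_eq_sum, gaussianMatrix, Matrix.of_apply, corrMatrix]
  simp only [div_mul_eq_mul_div, mul_div_assoc]
  rw [integral_finsetSum]
  · refine Finset.sum_congr rfl fun i _ => ?_
    rw [integral_finsetSum]
    · refine Finset.sum_congr rfl fun j _ => ?_
      rw [integral_const_mul, hK _ (by positivity)]
    · exact fun j _ => (integrable_exp_neg_sq hh _).const_mul _
  · exact fun i _ => integrable_finsetSum _ fun j _ => (integrable_exp_neg_sq hh _).const_mul _

theorem IsGaussianMixture.posDef_corrMatrix (hK : IsGaussianMixture K)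
    (hx : Function.Injective x) {θ : ℝ} (hθ : 0 < θ) : (corrMatrix K x θ).PosDef := by
  obtain ⟨μ, h, hμ, hh, hpos, hKd⟩ := hK
  refine PosDef.of_dotProduct_mulVec_pos (corrMatrix_isHermitian K x θ) fun z hz => ?_
  rw [star_trivial, quadForm_corrMatrix_eq_integral hh hKd x hθ]
  have hp : ∀ᵐ t ∂μ, 0 < z ⬝ᵥ (gaussianMatrix x (h t / θ) *ᵥ z) := by
    filter_upwards [hpos] with t ht
    exact (posDef_gaussianMatrix x hx (div_pos ht hθ)).dotProduct_mulVec_pos hz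
  rw [integral_pos_iff_support_of_nonneg_ae (hp.mono fun t ht => ht.le)
    (integrable_quadForm_gaussianMatrix hh x θ z)]
  have hs : ∀ᵐ t ∂μ, t ∈ Function.support fun t => z ⬝ᵥ (gaussianMatrix x (h t / θ) *ᵥ z) :=
    hp.mono fun t ht => ht.ne'
  exact one_pos.trans_eq (measure_univ.symm.trans (measure_congr (eventuallyEq_univ.2 hs)).symm)

/-- These sets exhaust `{h > 0}`. Confining `h` to a compact range makes the Gaussian bound uniform
on a set of positive mass. -/
theorem exists_measure_Icc_pos {μ : Measure ℝ} [IsProbabilityMeasure μ] {h : ℝ → ℝ}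
    (hpos : ∀ᵐ t ∂μ, 0 < h t) :
    ∃ k : ℕ, 0 < μ {t | h t ∈ Set.Icc ((k + 1 : ℝ)⁻¹) (k + 1)} := by
  by_contra! hcon
  have h0 : μ (⋃ k : ℕ, {t | h t ∈ Set.Icc ((k + 1 : ℝ)⁻¹) (k + 1)}) = 0 :=
    measure_iUnion_null fun k => le_antisymm (hcon k) zero_le
  have h1 : ∀ᵐ t ∂μ, False := by
    filter_upwards [hpos, measure_eq_zero_iff_ae_notMem.1 h0] with t ht hnot
    obtain ⟨k, hk⟩ := exists_nat_gt (max (h t) (h t)⁻¹)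
    refine hnot (Set.mem_iUnion.2 ⟨k, ?_, ?_⟩)
    · rw [inv_le_comm₀ (by positivity) ht]
      linarith [le_max_right (h t) (h t)⁻¹]
    · linarith [le_max_left (h t) (h t)⁻¹]
  simp at h1
  exact IsProbabilityMeasure.ne_zero μ h1

/-- The form is an average of nonnegative Gaussian forms, so it is at least its part over `S`, where
the determinant bound controls every eigenvalue from below. -/
theorem IsGaussianMixture.exists_le_quadForm (hK : IsGaussianMixture K)
    (hx : Function.Injective x) : ∃ c : ℝ, 0 < c ∧ ∃ N : ℕ, ∀ᶠ θ in atTop,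
      ∀ z : Fin n → ℝ, c * θ⁻¹ ^ N * (z ⬝ᵥ z) ≤ z ⬝ᵥ (corrMatrix K x θ *ᵥ z) := by
  obtain ⟨μ, h, hμ, hh, hpos, hKd⟩ := hK
  obtain ⟨c, hc, N, δ₀, hδ₀, hdet⟩ := exists_le_det_gaussianMatrix x hx
  obtain ⟨k, hk⟩ := exists_measure_Icc_pos hpos
  set S := {t | h t ∈ Set.Icc ((k + 1 : ℝ)⁻¹) (k + 1)}
  have hS : MeasurableSet S := hh measurableSet_Icc
  have hS' : 0 < μ.real S := ENNReal.toReal_pos hk.ne' (measure_ne_top _ _)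
  rcases Nat.eq_zero_or_pos n with rfl | hn
  · exact ⟨1, one_pos, 0, Eventually.of_forall fun θ z => by simp [dotProduct]⟩
  have hn' : (0 : ℝ) < n := by exact_mod_cast hn
  refine ⟨μ.real S * (c * ((k + 1 : ℝ)⁻¹) ^ N / (n : ℝ) ^ (n - 1)), by positivity, N, ?_⟩
  -- On `S`, `h t ≤ k + 1`; this threshold puts `h t / θ` below `δ₀`.
  filter_upwards [eventually_gt_atTop ((k + 1) / δ₀)] with θ hθ z
  have hθ0 : 0 < θ := lt_trans (by positivity) hθ
  rw [quadForm_corrMatrix_eq_integral hh hKd x hθ0]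
  have hint := integrable_quadForm_gaussianMatrix (μ := μ) hh x θ z
  have hnn : 0 ≤ᵐ[μ] fun t => z ⬝ᵥ (gaussianMatrix x (h t / θ) *ᵥ z) := by
    filter_upwards [hpos] with t ht
    exact (posDef_gaussianMatrix x hx (div_pos ht hθ0)).posSemidef.dotProduct_mulVec_nonneg z
  refine le_trans ?_ (setIntegral_le_integral (s := S) hint hnn)
  have hlow : ∀ t ∈ S, c * ((k + 1 : ℝ)⁻¹ * θ⁻¹) ^ N / (n : ℝ) ^ (n - 1) * (z ⬝ᵥ z) ≤
      z ⬝ᵥ (gaussianMatrix x (h t / θ) *ᵥ z) := by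
    intro t ht
    have ht0 : 0 < h t := lt_of_lt_of_le (by positivity) ht.1
    have hpd := posDef_gaussianMatrix x hx (div_pos ht0 hθ0)
    refine mul_dotProduct_self_le_of_le_eigenvalues hpd.isHermitian (fun i => ?_) z
    have htr : (gaussianMatrix x (h t / θ)).trace ≤ n := by
      simp [Matrix.trace, gaussianMatrix]
    refine le_trans ?_ (PosDef.det_div_le_eigenvalues hpd htr i)
    rw [Fintype.card_fin]
    gcongr
    refine le_trans ?_ (hdet _ (div_pos ht0 hθ0) ?_)
    · rw [div_eq_mul_inv]
      have := ht.1
      gcongr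
    · rw [div_lt_iff₀ hθ0]
      rw [div_lt_iff₀ hδ₀] at hθ
      linarith [ht.2]
  have := setIntegral_mono_on (μ := μ) (integrable_const _).integrableOn hint.integrableOn hS hlow
  refine le_trans (le_of_eq ?_) this
  rw [setIntegral_const, smul_eq_mul, mul_pow]
  ring

end Mixture

/-! ### Exponential polynomials and their leading terms. -/

section ExponentialPolynomials

/-- The exponential monomial `x ↦ exp (α x) x ^ j`, with `p = (α, j)`. -/
noncomputable def expMonomial (p : ℝ × ℕ) (x : ℝ) : ℝ := Real.exp (p.1 * x) * x ^ p.2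

theorem expMonomial_mul (p q : ℝ × ℕ) : expMonomial p * expMonomial q = expMonomial (p + q) := by
  ext x
  simp only [expMonomial, Pi.mul_apply, Prod.fst_add, Prod.snd_add, add_mul, Real.exp_add, pow_add]
  ring

/-- The algebra of exponential polynomials. -/
noncomputable def expPoly : Subalgebra ℝ (ℝ → ℝ) :=
  (Submodule.span ℝ (Set.range expMonomial)).toSubalgebra
    (Submodule.subset_span ⟨0, by ext x; simp [expMonomial]⟩)
    (fun f g hf hg => by
      have h := Submodule.mul_mem_mul hf hg
      rw [Submodule.span_mul_span] at h
      refine Submodule.span_mono ?_ h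
      rintro _ ⟨_, ⟨p, rfl⟩, _, ⟨q, rfl⟩, rfl⟩
      exact ⟨p + q, (expMonomial_mul p q).symm⟩)

theorem mem_expPoly {g : ℝ → ℝ} :
    g ∈ expPoly ↔ g ∈ Submodule.span ℝ (Set.range expMonomial) := Iff.rfl

theorem expMonomial_mem (p : ℝ × ℕ) : expMonomial p ∈ expPoly :=
  Submodule.subset_span ⟨p, rfl⟩

theorem expMonomial_zero_right (α : ℝ) : expMonomial (α, 0) = fun x => Real.exp (α * x) := by
  ext x; simp [expMonomial]

theorem exp_mul_mem_expPoly (α : ℝ) : (fun x => Real.exp (α * x)) ∈ expPoly :=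
  expMonomial_zero_right α ▸ expMonomial_mem (α, 0)

theorem id_mem_expPoly : (fun x => x) ∈ expPoly := by
  convert expMonomial_mem (0, 1) using 1
  ext x; simp [expMonomial]

theorem const_mem_expPoly (c : ℝ) : (fun _ => c) ∈ expPoly := expPoly.algebraMap_mem c

theorem expPoly_comp_affine {g : ℝ → ℝ} (hg : g ∈ expPoly) (k c : ℝ) :
    (fun x => g (k * x + c)) ∈ expPoly := by
  induction hg using Submodule.span_induction with
  | mem g hg =>
    obtain ⟨⟨α, j⟩, rfl⟩ := hg
    have h1 := expPoly.mul_mem (const_mem_expPoly (Real.exp (α * c))) (exp_mul_mem_expPoly (α * k))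
    have h2 := expPoly.pow_mem (expPoly.add_mem
      (expPoly.mul_mem (const_mem_expPoly k) id_mem_expPoly) (const_mem_expPoly c)) j
    convert expPoly.mul_mem h1 h2 using 1
    ext x
    simp only [expMonomial, Pi.mul_apply, Pi.pow_apply, Pi.add_apply, ← Real.exp_add]
    ring_nf
  | zero => exact expPoly.zero_mem
  | add f g _ _ hf hg => exact expPoly.add_mem hf hg
  | smul a f _ hf => exact expPoly.smul_mem hf a

/-- Integration by parts lowers `j` when `α ≠ 0`. When `α = 0` the power of `x` rises, which is why
powers, logarithms in terms of `θ`, must be admitted. -/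
theorem exists_antideriv_expMonomial (α : ℝ) (j : ℕ) :
    ∃ G ∈ expPoly, ∀ x, HasDerivAt G (expMonomial (α, j) x) x := by
  rcases eq_or_ne α 0 with rfl | hα
  · refine ⟨_, expPoly.smul_mem (expMonomial_mem (0, j + 1)) ((j + 1 : ℝ)⁻¹), fun x => ?_⟩
    have h := (hasDerivAt_pow (j + 1) x).const_mul ((j + 1 : ℝ)⁻¹)
    have e : (j + 1 : ℝ)⁻¹ • expMonomial (0, j + 1) = fun y => (j + 1 : ℝ)⁻¹ * y ^ (j + 1) := by
      ext y; simp [expMonomial]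
    rw [e]
    refine h.congr_deriv ?_
    · have : (j + 1 : ℝ) ≠ 0 := by positivity
      simp only [expMonomial, zero_mul, Real.exp_zero, Nat.cast_add, Nat.cast_one,
        add_tsub_cancel_right]
      field_simp
  · induction j with
    | zero =>
      refine ⟨_, expPoly.smul_mem (expMonomial_mem (α, 0)) α⁻¹, fun x => ?_⟩
      have h := (((hasDerivAt_id x).const_mul α).exp).const_mul α⁻¹
      rw [expMonomial_zero_right]
      refine h.congr_deriv ?_
      simp only [id]
      field_simp
    | succ j ih =>
      obtain ⟨G, hG, hd⟩ := ih
      refine ⟨_, expPoly.sub_mem (expPoly.smul_mem (expMonomial_mem (α, j + 1)) α⁻¹)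
        (expPoly.smul_mem hG (α⁻¹ * (j + 1))), fun x => ?_⟩
      have h1 := ((((hasDerivAt_id x).const_mul α).exp).mul
        (hasDerivAt_pow (j + 1) x)).const_mul α⁻¹
      have h := h1.sub ((hd x).const_mul (α⁻¹ * (j + 1)))
      refine h.congr_deriv ?_
      simp only [expMonomial, id, Nat.cast_add, Nat.cast_one, add_tsub_cancel_right]
      field_simp
      ring

theorem exists_antideriv_expPoly {g : ℝ → ℝ} (hg : g ∈ expPoly) :
    ∃ G ∈ expPoly, ∀ x, HasDerivAt G (g x) x := by
  induction hg using Submodule.span_induction with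
  | mem g hg =>
    obtain ⟨⟨α, j⟩, rfl⟩ := hg
    exact exists_antideriv_expMonomial α j
  | zero => exact ⟨0, expPoly.zero_mem, fun x => hasDerivAt_const x 0⟩
  | add f g _ _ hf hg =>
    obtain ⟨F, hF, hF'⟩ := hf
    obtain ⟨G, hG, hG'⟩ := hg
    exact ⟨F + G, expPoly.add_mem hF hG, fun x => (hF' x).add (hG' x)⟩
  | smul a f _ hf =>
    obtain ⟨F, hF, hF'⟩ := hf
    exact ⟨a • F, expPoly.smul_mem hF a, fun x => (hF' x).const_smul a⟩

theorem expMonomial_isLittleO {p q : ℝ × ℕ} (h : toLex p < toLex q) :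
    expMonomial p =o[atTop] expMonomial q := by
  rw [Prod.Lex.toLex_lt_toLex] at h
  rcases h with h | ⟨h1, h2⟩
  · have h1 : (fun x => Real.exp (p.1 * x) * x ^ p.2) =o[atTop]
        fun x => Real.exp (p.1 * x) * Real.exp ((q.1 - p.1) * x) :=
      (isBigO_refl _ _).mul_isLittleO (isLittleO_pow_exp_pos_mul_atTop _ (sub_pos.2 h))
    refine h1.trans_isBigO (IsBigO.of_bound 1 ?_)
    filter_upwards [eventually_ge_atTop 1] with x hx
    rw [← Real.exp_add, expMonomial, norm_mul, one_mul]
    ring_nf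
    refine le_mul_of_one_le_right (norm_nonneg _) ?_
    rw [norm_pow]
    exact one_le_pow₀ (hx.trans (le_abs_self x))
  · have h3 : expMonomial p = fun x => Real.exp (q.1 * x) * x ^ p.2 := by
      ext x; rw [expMonomial, h1]
    rw [h3]
    exact (isBigO_refl _ _).mul_isLittleO (isLittleO_pow_pow_atTop_of_lt h2)

theorem expMonomial_eventually_pos (p : ℝ × ℕ) : ∀ᶠ x in atTop, 0 < expMonomial p x := by
  filter_upwards [eventually_gt_atTop 0] with x hx
  unfold expMonomial
  positivity

/-- Growth at infinity follows the lexicographic order on `(α, j)`, so the largest pair with nonzero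
coefficient dominates. -/
theorem expPoly_isEquivalent {g : ℝ → ℝ} (hg : g ∈ expPoly) :
    g = 0 ∨ ∃ (c : ℝ) (p : ℝ × ℕ), c ≠ 0 ∧ g ~[atTop] fun x => c * expMonomial p x := by
  rw [mem_expPoly, Finsupp.mem_span_range_iff_exists_finsupp] at hg
  obtain ⟨a, rfl⟩ := hg
  rcases a.support.eq_empty_or_nonempty with h | h
  · left
    rw [Finsupp.support_eq_empty.1 h, Finsupp.sum_zero_index]
  · right
    obtain ⟨q, hq, hmax⟩ := Finset.exists_max_image a.support toLex h
    have haq : a q ≠ 0 := Finsupp.mem_support_iff.1 hq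
    refine ⟨a q, q, haq, ?_⟩
    rw [IsEquivalent, Finsupp.sum, ← Finset.add_sum_erase _ _ hq]
    have : (a q • expMonomial q + ∑ p ∈ a.support.erase q, a p • expMonomial p) -
        (fun x => a q * expMonomial q x) =
        fun x => ∑ p ∈ a.support.erase q, a p * expMonomial p x := by
      ext x
      simp [Finset.sum_apply]
    rw [this]
    suffices h : ∀ p ∈ a.support.erase q,
        (fun x => a p * expMonomial p x) =o[atTop] fun x => a q * expMonomial q x from
      IsLittleO.fun_sum h
    intro p hp
    refine IsLittleO.trans_isBigO ?_ (isBigO_self_const_mul haq (expMonomial q) atTop)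
    have hne : toLex p ≠ toLex q :=
      fun h => Finset.ne_of_mem_erase hp (toLex.injective h)
    exact (expMonomial_isLittleO (lt_of_le_of_ne (hmax p (Finset.mem_of_mem_erase hp))
      hne)).const_mul_left _

theorem expPoly_isBigO {g : ℝ → ℝ} (hg : g ∈ expPoly) :
    ∃ M : ℕ, g =O[atTop] fun x => Real.exp (M * x) := by
  rcases expPoly_isEquivalent hg with rfl | ⟨c, p, -, h⟩
  · exact ⟨0, isBigO_zero _ _⟩
  · obtain ⟨M, hM⟩ := exists_nat_gt p.1
    refine ⟨M, h.isBigO.trans (IsBigO.const_mul_left ?_ c)⟩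
    have := expMonomial_isLittleO (p := p) (q := (M, 0)) (Prod.Lex.toLex_lt_toLex.2 (Or.inl hM))
    exact expMonomial_zero_right (M : ℝ) ▸ this.isBigO

end ExponentialPolynomials

/-! ### Asymptotic expansions to all orders. -/

section Expansions

/-- `f` agrees with an exponential polynomial up to `O(exp (-β x))` at infinity. -/
def HasExpExpansion (f : ℝ → ℝ) (β : ℝ) : Prop :=
  ∃ g ∈ expPoly, (fun x => f x - g x) =O[atTop] fun x => Real.exp (-β * x)

theorem isBigO_exp_mul_of_le {α β : ℝ} (h : α ≤ β) :
    (fun x => Real.exp (α * x)) =O[atTop] fun x => Real.exp (β * x) := by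
  refine IsBigO.of_bound 1 ?_
  filter_upwards [eventually_ge_atTop 0] with x hx
  rw [one_mul, Real.norm_eq_abs, Real.norm_eq_abs, Real.abs_exp, Real.abs_exp]
  gcongr

theorem isLittleO_exp_mul_of_lt {α β : ℝ} (h : α < β) :
    (fun x => Real.exp (α * x)) =o[atTop] fun x => Real.exp (β * x) := by
  have := expMonomial_isLittleO (p := (α, 0)) (q := (β, 0)) (Prod.Lex.toLex_lt_toLex.2 (Or.inl h))
  rwa [expMonomial_zero_right, expMonomial_zero_right] at this

theorem HasExpExpansion.mono {f : ℝ → ℝ} {β γ : ℝ} (h : HasExpExpansion f β) (hγ : γ ≤ β) :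
    HasExpExpansion f γ := by
  obtain ⟨g, hg, hO⟩ := h
  exact ⟨g, hg, hO.trans (isBigO_exp_mul_of_le (by linarith))⟩

theorem HasExpExpansion.comp_affine {f : ℝ → ℝ} {β k : ℝ} (h : HasExpExpansion f β) (hk : 0 < k)
    (c : ℝ) : HasExpExpansion (fun x => f (k * x + c)) (β * k) := by
  obtain ⟨g, hg, hO⟩ := h
  refine ⟨_, expPoly_comp_affine hg k c, ?_⟩
  have ht : Tendsto (fun x : ℝ => k * x + c) atTop atTop :=
    tendsto_atTop_add_const_right _ _ (tendsto_id.const_mul_atTop hk)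
  refine (hO.comp_tendsto ht).trans ?_
  have : ((fun x => Real.exp (-β * x)) ∘ fun x => k * x + c) =
      fun x => Real.exp (-β * c) * Real.exp (-(β * k) * x) := by
    ext x
    simp only [Function.comp_apply, ← Real.exp_add]
    ring_nf
  rw [this]
  exact (isBigO_refl _ _).const_mul_left _

/-- Functions with an expansion by exponential polynomials to every order. -/
noncomputable def expExpandable : Subalgebra ℝ (ℝ → ℝ) where
  carrier := {f | ∀ N : ℕ, HasExpExpansion f N}
  algebraMap_mem' c N := ⟨_, const_mem_expPoly c, by simpa using isBigO_zero _ _⟩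
  add_mem' := by
    intro f₁ f₂ h₁ h₂ N
    obtain ⟨g₁, hg₁, hO₁⟩ := h₁ N
    obtain ⟨g₂, hg₂, hO₂⟩ := h₂ N
    refine ⟨_, expPoly.add_mem hg₁ hg₂, (hO₁.add hO₂).congr_left fun x => ?_⟩
    simp only [Pi.add_apply]
    ring
  mul_mem' := by
    intro f₁ f₂ h₁ h₂ N
    -- The error splits as `f₁ (f₂ - g₂) + (f₁ - g₁) g₂`. A crude expansion first fixes the growth
    -- `M₀` of `f₁`; then `g₂` is chosen, with growth `M₂`, and only then `g₁`, so that the orders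
    -- are not circular.
    obtain ⟨g₀, hg₀, hO₀⟩ := h₁ 0
    obtain ⟨M₀, hM₀⟩ := expPoly_isBigO hg₀
    have hf₁ : f₁ =O[atTop] fun x => Real.exp (M₀ * x) := by
      have := (hO₀.trans (isBigO_exp_mul_of_le (β := M₀) (by simp))).add hM₀
      simpa using this
    obtain ⟨g₂, hg₂, hO₂⟩ := h₂ (N + M₀)
    obtain ⟨M₂, hM₂⟩ := expPoly_isBigO hg₂
    obtain ⟨g₁, hg₁, hO₁⟩ := h₁ (N + M₂)
    refine ⟨_, expPoly.mul_mem hg₁ hg₂, ?_⟩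
    have e₁ : (fun x => f₁ x * (f₂ x - g₂ x)) =O[atTop] fun x => Real.exp (-(N : ℝ) * x) := by
      refine (hf₁.mul hO₂).congr_right fun x => ?_
      rw [← Real.exp_add]
      push_cast
      ring_nf
    have e₂ : (fun x => (f₁ x - g₁ x) * g₂ x) =O[atTop] fun x => Real.exp (-(N : ℝ) * x) := by
      refine (hO₁.mul hM₂).congr_right fun x => ?_
      rw [← Real.exp_add]
      push_cast
      ring_nf
    refine (e₁.add e₂).congr_left fun x => ?_
    simp only [Pi.mul_apply]
    ring

theorem expExpandable_comp_affine {f : ℝ → ℝ} (hf : f ∈ expExpandable) {k : ℝ} (hk : 1 ≤ k)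
    (c : ℝ) : (fun x => f (k * x + c)) ∈ expExpandable := fun N =>
  ((hf N).comp_affine (by linarith) c).mono (le_mul_of_one_le_right (Nat.cast_nonneg N) hk)

theorem const_mem_expExpandable (c : ℝ) : (fun _ => c) ∈ expExpandable :=
  expExpandable.algebraMap_mem c

/-- The Taylor polynomial of `φ` at `0`, evaluated at `e^{-x}`, is an exponential polynomial. -/
theorem AnalyticAt.comp_exp_neg_mem_expExpandable {φ : ℝ → ℝ} (hφ : AnalyticAt ℝ φ 0) :
    (fun x => φ (Real.exp (-x))) ∈ expExpandable := by
  intro N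
  obtain ⟨p, hp⟩ := hφ
  refine ⟨fun x => p.partialSum N (Real.exp (-x)), ?_, ?_⟩
  · have : (fun x => p.partialSum N (Real.exp (-x))) =
        ∑ k ∈ Finset.range N, p.coeff k • fun x => Real.exp (-(k : ℝ) * x) := by
      ext x
      simp only [FormalMultilinearSeries.partialSum, FormalMultilinearSeries.apply_eq_pow_smul_coeff,
        Finset.sum_apply, Pi.smul_apply, smul_eq_mul, ← Real.exp_nat_mul]
      refine Finset.sum_congr rfl fun k _ => ?_
      rw [mul_comm]
      ring_nf
    rw [this]
    exact expPoly.sum_mem fun k _ => expPoly.smul_mem (exp_mul_mem_expPoly _) _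
  · have ht : Tendsto (fun x : ℝ => Real.exp (-x)) atTop (nhds 0) :=
      Real.tendsto_exp_neg_atTop_nhds_zero
    have := (hp.isBigO_sub_partialSum_pow N).comp_tendsto ht
    refine (this.congr (fun x => by simp) fun x => ?_)
    simp only [Function.comp_apply, Real.norm_eq_abs, Real.abs_exp, ← Real.exp_nat_mul]
    ring_nf

/-- Both functions may be replaced by exponential polynomials with error negligible against `g`.
Comparing leading monomials, the quotient tends to zero or to a ratio of coefficients; the third
case contradicts `f = O(g)`. -/
theorem exists_tendsto_div_of_mem_expExpandable {f g : ℝ → ℝ} (hf : f ∈ expExpandable)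
    (hg : g ∈ expExpandable) {N : ℕ} (hN : (fun x => Real.exp (-(N : ℝ) * x)) =O[atTop] g)
    (hfg : f =O[atTop] g) : ∃ l, Tendsto (fun x => f x / g x) atTop (nhds l) := by
  -- One order beyond `N`, so that the remainders are `o(g)` rather than `O(g)`.
  obtain ⟨f₁, hf₁, hfO⟩ := hf (N + 1)
  obtain ⟨g₁, hg₁, hgO⟩ := hg (N + 1)
  have hlt : (fun x => Real.exp (-((N + 1 : ℕ) : ℝ) * x)) =o[atTop] g :=
    (isLittleO_exp_mul_of_lt (by push_cast; linarith)).trans_isBigO hN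
  have hfo := hfO.trans_isLittleO hlt
  have hgo := hgO.trans_isLittleO hlt
  have hlim : Tendsto (fun x => (f x - f₁ x) / g x) atTop (nhds 0) := hfo.tendsto_div_nhds_zero
  suffices h : ∃ l, Tendsto (fun x => f₁ x / g x) atTop (nhds l) by
    obtain ⟨l, hl⟩ := h
    refine ⟨0 + l, (hlim.add hl).congr fun x => ?_⟩
    ring
  have hg_ne : ∀ᶠ x in atTop, g x ≠ 0 := by
    obtain ⟨C, hC⟩ := hN.bound
    filter_upwards [hC] with x hx h0
    rw [h0, norm_zero, mul_zero, Real.norm_eq_abs, Real.abs_exp] at hx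
    exact absurd (Real.exp_pos (-(N : ℝ) * x)) (not_lt.2 hx)
  have hequiv : g₁ ~[atTop] g := by
    rw [IsEquivalent]
    exact hgo.neg_left.congr_left fun x => by simp
  have hf₁O : f₁ =O[atTop] g := (hfg.sub hfo.isBigO).congr_left fun x => by ring
  rcases expPoly_isEquivalent hf₁ with rfl | ⟨d, p, hd, hfp⟩
  · exact ⟨0, by simp⟩
  rcases expPoly_isEquivalent hg₁ with rfl | ⟨c, q, hc, hgq⟩
  · have h0 := (isEquivalent_zero_iff_eventually_zero).1 hequiv.symm
    obtain ⟨x, h1, h2⟩ := (hg_ne.and h0).exists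
    exact absurd h2 h1
  have hgm : g ~[atTop] fun x => c * expMonomial q x := hequiv.symm.trans hgq
  rcases lt_trichotomy (toLex p) (toLex q) with h | h | h
  · refine ⟨0, IsLittleO.tendsto_div_nhds_zero ?_⟩
    have h1 := (hfp.isBigO.trans (isBigO_const_mul_self d _ _)).trans_isLittleO
      (expMonomial_isLittleO h)
    refine h1.trans_isBigO (((isBigO_self_const_mul hc _ _)).trans hgm.symm.isBigO)
  · obtain rfl := toLex.injective h
    refine ⟨d / c, ((hfp.div hgm).symm.tendsto_nhds ?_)⟩
    refine tendsto_const_nhds.congr' ?_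
    filter_upwards [expMonomial_eventually_pos p] with x hx
    simp only [Pi.div_apply]
    field_simp
  · exfalso
    have h1 : expMonomial p =O[atTop] expMonomial q :=
      ((isBigO_self_const_mul hd _ _).trans hfp.symm.isBigO).trans
        (hf₁O.trans (hgm.isBigO.trans (isBigO_const_mul_self c _ _)))
    have h2 := h1.trans_isLittleO (expMonomial_isLittleO h)
    exact h2.not_isBigO (expMonomial_eventually_pos p |>.mono fun x hx => hx.ne').frequently
      (isBigO_refl _ _)

end Expansions

/-! ### Expansion of the Bessel integral. -/

section BesselIntegral

theorem integrable_exp_neg_mul_abs {b : ℝ} (hb : 0 < b) :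
    Integrable fun u : ℝ => Real.exp (-(b * |u|)) := by
  rw [← integrableOn_univ, ← Set.Iic_union_Ioi (a := (0 : ℝ))]
  refine IntegrableOn.union ?_ ?_
  · refine (integrableOn_exp_mul_Iic hb 0).congr_fun (fun u hu => ?_) measurableSet_Iic
    simp [abs_of_nonpos (Set.mem_Iic.1 hu)]
  · refine (integrableOn_exp_mul_Ioi (neg_lt_zero.2 hb) 0).congr_fun (fun u hu => ?_)
      measurableSet_Ioi
    simp [abs_of_pos (Set.mem_Ioi.1 hu)]

theorem exp_neg_exp_le (k : ℕ) (u : ℝ) :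
    Real.exp (-Real.exp u) ≤ k.factorial * Real.exp (-(k * u)) := by
  have h := Real.pow_div_factorial_le_exp (Real.exp u) (Real.exp_pos u).le k
  rw [div_le_iff₀ (by positivity), ← Real.exp_nat_mul] at h
  rw [Real.exp_neg, Real.exp_neg, ← div_eq_mul_inv, le_div_iff₀ (Real.exp_pos _), inv_mul_eq_div,
    div_le_iff₀ (Real.exp_pos _)]
  linarith

/-- The integrand of `besselIntegral`. -/
noncomputable def besselIntegrand (a x u : ℝ) : ℝ :=
  Real.exp (-Real.exp u - Real.exp (-x - u) + a * u)

/-- `∫ exp (-eᵘ - e⁻ˣ⁻ᵘ) eᵃᵘ du`, which is `2 (z / 2) ^ a 𝒦_a z` for `z = 2 e⁻ˣᐟ²`. -/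
noncomputable def besselIntegral (a x : ℝ) : ℝ := ∫ u, besselIntegrand a x u

/-- Domination uniform in `x ≤ X`, for differentiating under the integral: `exp (-eᵘ)` handles `u ≥
0` and `exp (-e⁻ˣ⁻ᵘ)` handles `u ≤ 0`. -/
theorem exists_besselIntegrand_le (a X : ℝ) :
    ∃ C, ∀ x ≤ X, ∀ u, besselIntegrand a x u ≤ C * Real.exp (-(1 * |u|)) := by
  obtain ⟨k, hk⟩ := exists_nat_ge (|a| + 1)
  have ha := abs_le.1 (le_refl |a|)
  refine ⟨k.factorial * Real.exp (k * |X|), fun x hx u => ?_⟩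
  unfold besselIntegrand
  rcases le_total 0 u with hu | hu
  · calc _ ≤ Real.exp (-Real.exp u) * Real.exp (a * u) := by
          rw [← Real.exp_add]
          gcongr
          linarith [Real.exp_pos (-x - u)]
      _ ≤ k.factorial * Real.exp (-(k * u)) * Real.exp (a * u) := by
          gcongr
          exact exp_neg_exp_le k u
      _ ≤ _ := by
          rw [mul_assoc, mul_assoc, ← Real.exp_add, ← Real.exp_add, abs_of_nonneg hu]
          refine mul_le_mul_of_nonneg_left (Real.exp_le_exp.2 ?_) (by positivity)
          nlinarith [mul_nonneg (Nat.cast_nonneg (α := ℝ) k) (abs_nonneg X)]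
  · calc _ ≤ Real.exp (-Real.exp (-x - u)) * Real.exp (a * u) := by
          rw [← Real.exp_add]
          gcongr
          linarith [Real.exp_pos u]
      _ ≤ k.factorial * Real.exp (-(k * (-x - u))) * Real.exp (a * u) := by
          gcongr
          exact exp_neg_exp_le k _
      _ ≤ _ := by
          rw [mul_assoc, mul_assoc, ← Real.exp_add, ← Real.exp_add, abs_of_nonpos hu]
          refine mul_le_mul_of_nonneg_left (Real.exp_le_exp.2 ?_) (by positivity)
          nlinarith [mul_le_mul_of_nonneg_left (hx.trans (le_abs_self X))
            (Nat.cast_nonneg (α := ℝ) k)]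

theorem continuous_besselIntegrand (a x : ℝ) : Continuous (besselIntegrand a x) := by
  unfold besselIntegrand
  fun_prop

theorem integrable_besselIntegrand (a x : ℝ) : Integrable (besselIntegrand a x) := by
  obtain ⟨C, hC⟩ := exists_besselIntegrand_le a x
  refine ((integrable_exp_neg_mul_abs one_pos).const_mul C).mono'
    (continuous_besselIntegrand a x).aestronglyMeasurable (ae_of_all _ fun u => ?_)
  rw [Real.norm_eq_abs, besselIntegrand, Real.abs_exp]
  exact hC x le_rfl u

/-- The substitution `u ↦ -x - u` exchanges the two inner exponentials. -/
theorem besselIntegral_neg (a x : ℝ) :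
    besselIntegral (-a) x = Real.exp (a * x) * besselIntegral a x := by
  rw [besselIntegral, besselIntegral, ← integral_const_mul,
    ← integral_sub_left_eq_self (besselIntegrand (-a) x) volume (-x)]
  congr 1
  ext u
  simp only [besselIntegrand, ← Real.exp_add]
  ring_nf

theorem hasDerivAt_besselIntegral (a x : ℝ) :
    HasDerivAt (besselIntegral a) (Real.exp (-x) * besselIntegral (a - 1) x) x := by
  obtain ⟨C, hC⟩ := exists_besselIntegrand_le (a - 1) (x + 1)
  have key : ∀ y u, HasDerivAt (fun y => besselIntegrand a y u)
      (Real.exp (-y) * besselIntegrand (a - 1) y u) y := by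
    intro y u
    have h1 : HasDerivAt (fun y : ℝ => Real.exp (-y - u)) (Real.exp (-y - u) * (-1)) y :=
      ((hasDerivAt_neg y).sub_const u).exp
    have h2 := ((h1.const_sub (-Real.exp u)).add_const (a * u)).exp
    refine h2.congr_deriv ?_
    simp only [besselIntegrand, mul_neg, mul_one, neg_neg, ← Real.exp_add]
    ring_nf
  have h := (hasDerivAt_integral_of_dominated_loc_of_deriv_le (μ := volume)
    (F := besselIntegrand a) (F' := fun y u => Real.exp (-y) * besselIntegrand (a - 1) y u)
    (x₀ := x) (bound := fun u => Real.exp (-(x - 1)) * (C * Real.exp (-(1 * |u|))))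
    (Metric.ball_mem_nhds x one_pos)
    (Eventually.of_forall fun y => (continuous_besselIntegrand a y).aestronglyMeasurable)
    (integrable_besselIntegrand a x)
    ((continuous_besselIntegrand (a - 1) x).const_mul _).aestronglyMeasurable
    (ae_of_all _ fun u y hy => ?_)
    (((integrable_exp_neg_mul_abs one_pos).const_mul C).const_mul _)
    (ae_of_all _ fun u y _ => key y u)).2
  · rwa [integral_const_mul] at h
  · rw [Metric.mem_ball, Real.dist_eq, abs_lt] at hy
    have h0 : 0 < besselIntegrand (a - 1) y u := Real.exp_pos _
    rw [Real.norm_of_nonneg (by positivity)]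
    gcongr
    · linarith
    · exact hC y (by linarith) u

theorem besselIntegral_isBigO {a b : ℝ} (hb0 : 0 < b) (hb1 : b ≤ 1) (hab : 0 < a + b) :
    (besselIntegral a) =O[atTop] fun x => Real.exp (b * x) := by
  obtain ⟨k, hk⟩ := exists_nat_ge (2 * (a + b))
  have hbound : ∀ u : ℝ, Real.exp (-Real.exp u + (a + b) * u) ≤
      k.factorial * Real.exp (-((a + b) * |u|)) := by
    intro u
    rw [Real.exp_add]
    rcases le_total 0 u with hu | hu
    · refine (mul_le_mul_of_nonneg_right (exp_neg_exp_le k u) (Real.exp_pos _).le).trans ?_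
      rw [mul_assoc, ← Real.exp_add, abs_of_nonneg hu]
      gcongr
      nlinarith
    · have h1 : Real.exp (-Real.exp u) ≤ k.factorial := by
        refine le_trans (Real.exp_le_one_iff.2 (by linarith [Real.exp_pos u])) ?_
        exact_mod_cast Nat.one_le_iff_ne_zero.2 (Nat.factorial_ne_zero k)
      refine (mul_le_mul_of_nonneg_right h1 (Real.exp_pos _).le).trans ?_
      rw [abs_of_nonpos hu]
      gcongr
      linarith
  have hint : Integrable fun u : ℝ => Real.exp (-Real.exp u + (a + b) * u) :=
    ((integrable_exp_neg_mul_abs hab).const_mul (k.factorial : ℝ)).mono'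
      (by fun_prop) (ae_of_all _ fun u => by
        rw [Real.norm_eq_abs, Real.abs_exp]; exact hbound u)
  refine IsBigO.of_bound (∫ u : ℝ, Real.exp (-Real.exp u + (a + b) * u))
    (Eventually.of_forall fun x => ?_)
  rw [besselIntegral, Real.norm_eq_abs, Real.norm_eq_abs, Real.abs_exp, abs_of_nonneg
    (integral_nonneg fun u => (Real.exp_pos _).le), mul_comm, ← integral_const_mul]
  refine integral_mono (integrable_besselIntegrand a x) (hint.const_mul _) fun u => ?_
  simp only [besselIntegrand, ← Real.exp_add]
  refine Real.exp_le_exp.2 ?_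
  -- With `w = x + u`, the claim is `-e^{-w} ≤ b w`. For `w ≤ 0` it follows from `e^{-w} ≥ 1 - w`
  -- and `b ≤ 1`.
  have h := Real.add_one_le_exp (-x - u)
  have h0 := Real.exp_pos (-x - u)
  rcases le_total 0 (x + u) with hw | hw
  · nlinarith
  · nlinarith

/-- With `u = (C / b) e^{-bx}`, `h - u` increases and `h + u` decreases beyond `X`. The supremum of
the former is the limit, trapped between them. -/
theorem exists_isBigO_sub_const_of_deriv {h h' : ℝ → ℝ} {b : ℝ} (hb : 0 < b)
    (hd : ∀ x, HasDerivAt h (h' x) x) (hO : h' =O[atTop] fun x => Real.exp (-b * x)) :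
    ∃ c, (fun x => h x - c) =O[atTop] fun x => Real.exp (-b * x) := by
  obtain ⟨C, hC⟩ := hO.bound
  obtain ⟨X, hX⟩ := eventually_atTop.1 hC
  simp only [Real.norm_eq_abs, Real.abs_exp] at hX
  let u : ℝ → ℝ := fun x => C / b * Real.exp (-b * x)
  have hu : ∀ x, HasDerivAt u (-(C * Real.exp (-b * x))) x := fun x => by
    have := (((hasDerivAt_id x).const_mul (-b)).exp).const_mul (C / b)
    refine this.congr_deriv ?_
    simp only [id]
    field_simp
  have hmono : MonotoneOn (fun x => h x - u x) (Set.Ici X) := by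
    refine monotoneOn_of_hasDerivWithinAt_nonneg (convex_Ici X)
      (fun x _ => ((hd x).sub (hu x)).continuousAt.continuousWithinAt)
      (fun x _ => ((hd x).sub (hu x)).hasDerivWithinAt) fun x hx => ?_
    rw [interior_Ici] at hx
    have := abs_le.1 (hX x (le_of_lt hx))
    linarith [this.1]
  have hanti : AntitoneOn (fun x => h x + u x) (Set.Ici X) := by
    refine antitoneOn_of_hasDerivWithinAt_nonpos (convex_Ici X)
      (fun x _ => ((hd x).add (hu x)).continuousAt.continuousWithinAt)
      (fun x _ => ((hd x).add (hu x)).hasDerivWithinAt) fun x hx => ?_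
    rw [interior_Ici] at hx
    have := abs_le.1 (hX x (le_of_lt hx))
    linarith [this.2]
  have hC0 : 0 ≤ C := by
    have := (abs_nonneg _).trans (hX X le_rfl)
    exact nonneg_of_mul_nonneg_left this (Real.exp_pos _)
  have hu0 : ∀ x, 0 ≤ u x := fun x => by positivity
  have hle : ∀ x ∈ Set.Ici X, ∀ y ∈ Set.Ici X, h x - u x ≤ h y + u y := by
    intro x hx y hy
    have h1 := hmono hx (Set.mem_Ici.2 (le_max_of_le_left hx : X ≤ max x y)) (le_max_left x y)
    have h2 := hanti hy (Set.mem_Ici.2 (le_max_of_le_left hx : X ≤ max x y)) (le_max_right x y)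
    simp only at h1 h2
    linarith [hu0 (max x y)]
  have hne : ((fun x => h x - u x) '' Set.Ici X).Nonempty := ⟨_, X, Set.self_mem_Ici, rfl⟩
  have hbdd : BddAbove ((fun x => h x - u x) '' Set.Ici X) := by
    refine ⟨h X + u X, ?_⟩
    rintro _ ⟨x, hx, rfl⟩
    exact hle x hx X Set.self_mem_Ici
  refine ⟨sSup ((fun x => h x - u x) '' Set.Ici X), IsBigO.of_bound (C / b) ?_⟩
  filter_upwards [eventually_ge_atTop X] with x hx
  have h1 := le_csSup hbdd ⟨x, hx, rfl⟩
  have h2 : sSup ((fun x => h x - u x) '' Set.Ici X) ≤ h x + u x := by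
    refine csSup_le hne ?_
    rintro _ ⟨y, hy, rfl⟩
    exact hle y hy x hx
  rw [Real.norm_eq_abs, Real.norm_eq_abs, Real.abs_exp, abs_le]
  simp only [u] at h1 h2
  constructor <;> linarith

theorem HasExpExpansion.besselIntegral_neg {a β : ℝ} (h : HasExpExpansion (besselIntegral a) β) :
    HasExpExpansion (besselIntegral (-a)) (β - a) := by
  obtain ⟨g, hg, hO⟩ := h
  refine ⟨_, expPoly.mul_mem (exp_mul_mem_expPoly a) hg, ?_⟩
  refine ((isBigO_refl (fun x => Real.exp (a * x)) atTop).mul hO).congr (fun x => ?_) fun x => ?_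
  · rw [_root_.besselIntegral_neg, Pi.mul_apply]
    ring
  · rw [← Real.exp_add]
    ring_nf

/-- Integrating `I_a' = e^{-x} I_{a-1}` gains one order; `β > -1` makes the remainder of the
derivative decay, so that only a constant is left undetermined. -/
theorem HasExpExpansion.besselIntegral_of_sub_one {a β : ℝ} (hβ : -1 < β)
    (h : HasExpExpansion (besselIntegral (a - 1)) β) :
    HasExpExpansion (besselIntegral a) (β + 1) := by
  obtain ⟨g, hg, hO⟩ := h
  obtain ⟨G, hG, hG'⟩ := exists_antideriv_expPoly (expPoly.mul_mem (exp_mul_mem_expPoly (-1)) hg)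
  obtain ⟨c, hc⟩ := exists_isBigO_sub_const_of_deriv (h := fun x => besselIntegral a x - G x)
    (b := β + 1) (by linarith) (fun x => (hasDerivAt_besselIntegral a x).sub (hG' x)) (by
      refine ((isBigO_refl (fun x => Real.exp (-x)) atTop).mul hO).congr (fun x => ?_) fun x => ?_
      · rw [Pi.mul_apply, neg_one_mul]
        ring
      · rw [← Real.exp_add]
        ring_nf)
  refine ⟨_, expPoly.add_mem hG (const_mem_expPoly c), hc.congr_left fun x => ?_⟩
  simp only [Pi.add_apply]
  ring

/-- The passage `1 - a → a - 1 → a`, reflection followed by integration, keeps the index in `[0, 1]`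
and raises the order from `(1 - a) / 2 + N / 2` to `a / 2 + (N + 1) / 2`. -/
theorem hasExpExpansion_besselIntegral_of_mem_Icc (N : ℕ) {a : ℝ} (ha0 : 0 ≤ a) (ha1 : a ≤ 1) :
    HasExpExpansion (besselIntegral a) (a / 2 + N / 2) := by
  induction N generalizing a with
  | zero =>
    have hpos : ∀ a : ℝ, 0 < a → a ≤ 1 → HasExpExpansion (besselIntegral a) (a / 2) := by
      intro a h0 h1
      have h : HasExpExpansion (besselIntegral (a - 1)) (a / 2 - 1) := by
        refine ⟨0, expPoly.zero_mem, ?_⟩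
        have := besselIntegral_isBigO (a := a - 1) (b := 1 - a / 2) (by linarith) (by linarith)
          (by linarith)
        simpa using this
      simpa using h.besselIntegral_of_sub_one (by linarith)
    -- At `a = 0` the direct bound would give only `β = -1`, which cannot be integrated; the route
    -- through indices `1` and `-1` starts from order `1 / 2` instead.
    rcases ha0.eq_or_lt with rfl | h0
    · have h1 := (hpos 1 one_pos le_rfl).besselIntegral_neg
      rw [← zero_sub] at h1
      exact (h1.besselIntegral_of_sub_one (by norm_num)).mono (by norm_num)
    · simpa using hpos a h0 ha1
  | succ N ih =>
    have h := (ih (a := 1 - a) (by linarith) (by linarith)).besselIntegral_neg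
    rw [neg_sub] at h
    have hN : (0 : ℝ) ≤ N := Nat.cast_nonneg N
    refine (h.besselIntegral_of_sub_one (by linarith)).mono ?_
    push_cast
    linarith

theorem besselIntegral_mem_expExpandable {a : ℝ} (ha : 0 ≤ a) :
    besselIntegral a ∈ expExpandable := by
  suffices h : ∀ k : ℕ, ∀ a : ℝ, 0 ≤ a → a ≤ k + 1 → besselIntegral a ∈ expExpandable by
    obtain ⟨k, hk⟩ := exists_nat_ge a
    exact h k a ha (by linarith)
  intro k
  induction k with
  | zero =>
    intro a h0 h1 N
    refine (hasExpExpansion_besselIntegral_of_mem_Icc (2 * N) h0 (by simpa using h1)).mono ?_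
    push_cast
    linarith
  | succ k ih =>
    intro a h0 h1
    rcases le_total a (k + 1) with h | h
    · exact ih a h0 h
    · intro N
      have hk : (0 : ℝ) ≤ k := Nat.cast_nonneg k
      have hN : (0 : ℝ) ≤ N := Nat.cast_nonneg N
      have := ih (a - 1) (by linarith) (by push_cast at h1; linarith) N
      exact (this.besselIntegral_of_sub_one (by linarith)).mono (by linarith)

end BesselIntegral

/-! ### The three kernels: mixture representation and expansion. -/

section Kernels

theorem integral_gammaMeasure {ν : ℝ} (hν : 0 < ν) (g : ℝ → ℝ) :
    ∫ t, g t ∂(ProbabilityTheory.gammaMeasure ν 1) =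
      (Real.Gamma ν)⁻¹ * ∫ t in Set.Ioi 0, t ^ (ν - 1) * Real.exp (-t) * g t := by
  have hm : Measurable (ProbabilityTheory.gammaPDF ν 1) :=
    (ProbabilityTheory.measurable_gammaPDFReal ν 1).ennreal_ofReal
  rw [ProbabilityTheory.gammaMeasure, integral_withDensity_eq_integral_toReal_smul hm
    (ae_of_all _ fun t => ENNReal.ofReal_lt_top), ← integral_const_mul,
    ← integral_Ici_eq_integral_Ioi, ← integral_indicator measurableSet_Ici]
  congr 1
  ext t
  rw [ProbabilityTheory.gammaPDF, ENNReal.toReal_ofReal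
    (ProbabilityTheory.gammaPDFReal_nonneg hν one_pos t), ProbabilityTheory.gammaPDFReal,
    Set.indicator_apply]
  by_cases ht : 0 ≤ t
  · rw [if_pos ht, if_pos (Set.mem_Ici.2 ht)]
    simp only [Real.one_rpow, one_mul, smul_eq_mul]
    ring
  · rw [if_neg ht, if_neg (by simpa using ht), zero_smul]

theorem ae_pos_gammaMeasure (ν : ℝ) : ∀ᵐ t ∂(ProbabilityTheory.gammaMeasure ν 1), 0 < t := by
  have hm : Measurable (ProbabilityTheory.gammaPDF ν 1) :=
    (ProbabilityTheory.measurable_gammaPDFReal ν 1).ennreal_ofReal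
  rw [ProbabilityTheory.gammaMeasure, ae_withDensity_iff hm]
  filter_upwards [Measure.ae_ne volume (0 : ℝ)] with t ht0 ht
  by_contra h
  exact ht (ProbabilityTheory.gammaPDF_of_neg (lt_of_le_of_ne (not_lt.1 h) ht0))

theorem isGaussianMixture_squaredExponentialKernel :
    IsGaussianMixture squaredExponentialKernel := by
  refine ⟨Measure.dirac 1, id, inferInstance, measurable_id, ?_, fun d _ => ?_⟩
  · rw [ae_dirac_eq]
    exact zero_lt_one' ℝ
  · simp [squaredExponentialKernel]

/-- `(1 + d²)^{-ν}` is the Laplace transform at `d²` of the gamma law of shape `ν`. -/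
theorem isGaussianMixture_rationalQuadraticKernel {ν : ℝ} (hν : 0 < ν) :
    IsGaussianMixture (rationalQuadraticKernel ν) := by
  refine ⟨ProbabilityTheory.gammaMeasure ν 1, Real.sqrt,
    ProbabilityTheory.isProbabilityMeasure_gammaMeasure hν one_pos, by fun_prop,
    (ae_pos_gammaMeasure ν).mono fun t ht => Real.sqrt_pos.2 ht, fun d _ => ?_⟩
  rw [integral_gammaMeasure hν]
  have h : ∀ t ∈ Set.Ioi (0 : ℝ), t ^ (ν - 1) * Real.exp (-t) * Real.exp (-(√t * d) ^ 2) =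
      t ^ (ν - 1) * Real.exp (-((1 + d ^ 2) * t)) := by
    intro t ht
    rw [mul_assoc, ← Real.exp_add, mul_pow, Real.sq_sqrt (le_of_lt ht)]
    ring_nf
  rw [setIntegral_congr_fun measurableSet_Ioi h,
    Real.integral_rpow_mul_exp_neg_mul_Ioi hν (by positivity), rationalQuadraticKernel,
    Real.rpow_neg (by positivity), one_div, Real.inv_rpow (by positivity)]
  have := (Real.Gamma_pos_of_pos hν).ne'
  field_simp

theorem integral_Ioi_eq_integral_comp_exp (g : ℝ → ℝ) :
    ∫ t in Set.Ioi 0, g t = ∫ u, Real.exp u * g (Real.exp u) := by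
  have h := integral_image_eq_integral_abs_deriv_smul MeasurableSet.univ
    (fun u _ => (Real.hasDerivAt_exp u).hasDerivWithinAt) Real.exp_injective.injOn g
  rw [Set.image_univ, Real.range_exp, Measure.restrict_univ] at h
  simpa using h

theorem integral_Ioi_rpow_mul_exp_eq_besselIntegral (ν x : ℝ) :
    ∫ t in Set.Ioi 0, t ^ (ν - 1) * Real.exp (-t) * Real.exp (-(Real.exp (-x) / t)) =
      besselIntegral ν x := by
  rw [integral_Ioi_eq_integral_comp_exp, besselIntegral]
  congr 1
  ext u
  rw [besselIntegrand, ← Real.exp_mul, ← Real.exp_sub, ← Real.exp_add, ← Real.exp_add,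
    ← Real.exp_add]
  ring_nf

theorem integrable_exp_neg_mul_cosh {z : ℝ} (hz : 0 < z) (a : ℝ) :
    Integrable fun t : ℝ => Real.exp (-(z * Real.cosh t)) * Real.exp (a * t) := by
  have h := ((integrable_besselIntegrand a (-2 * Real.log (z / 2))).comp_sub_right
    (-Real.log (z / 2))).const_mul (Real.exp (a * (-Real.log (z / 2))))
  refine h.congr (ae_of_all _ fun t => ?_)
  simp only [besselIntegrand, ← Real.exp_add]
  have h1 : Real.exp (t - -Real.log (z / 2)) = Real.exp t * (z / 2) := by
    rw [sub_neg_eq_add, Real.exp_add, Real.exp_log (by positivity)]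
  have h2 : Real.exp (-(-2 * Real.log (z / 2)) - (t - -Real.log (z / 2))) =
      Real.exp (-t) * (z / 2) := by
    rw [← Real.exp_log (show 0 < z / 2 by positivity), ← Real.exp_add, Real.log_exp]
    ring_nf
  rw [h1, h2, Real.cosh_eq]
  ring_nf

theorem besselK_eq_integral {z : ℝ} (hz : 0 < z) (ν : ℝ) :
    besselK ν z = 2⁻¹ * ∫ t : ℝ, Real.exp (-(z * Real.cosh t)) * Real.exp (ν * t) := by
  have hp := integrable_exp_neg_mul_cosh hz ν
  have hm := integrable_exp_neg_mul_cosh hz (-ν)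
  have h1 : ∫ t in Set.Iic (0 : ℝ), Real.exp (-(z * Real.cosh t)) * Real.exp (ν * t) =
      ∫ t in Set.Ioi (0 : ℝ), Real.exp (-(z * Real.cosh t)) * Real.exp (-ν * t) := by
    have := integral_comp_neg_Ioi (0 : ℝ)
      fun t => Real.exp (-(z * Real.cosh t)) * Real.exp (ν * t)
    simpa using this.symm
  rw [← integral_add_compl (measurableSet_Iic (a := (0 : ℝ))) hp, Set.compl_Iic, h1,
    ← integral_add hm.integrableOn hp.integrableOn, ← integral_const_mul, besselK]
  congr 1
  ext t
  rw [Real.cosh_eq (ν * t)]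
  ring_nf

/-- Shifting by `x / 2` splits `z cosh t`, for `z = 2 e^{-x/2}`, into the two exponentials of
`besselIntegrand`. -/
theorem besselK_two_mul_exp (ν x : ℝ) :
    besselK ν (2 * Real.exp (-x / 2)) =
      2⁻¹ * (Real.exp (ν * x / 2) * besselIntegral ν x) := by
  rw [besselK_eq_integral (by positivity), besselIntegral,
    ← integral_const_mul (Real.exp (ν * x / 2)),
    ← integral_sub_right_eq_self (fun u => Real.exp (ν * x / 2) * besselIntegrand ν x u) (x / 2)]
  congr 2
  ext t
  simp only [besselIntegrand, ← Real.exp_add]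
  have h : 2 * Real.exp (-x / 2) * Real.cosh t =
      Real.exp (t - x / 2) + Real.exp (-x - (t - x / 2)) := by
    rw [Real.cosh_eq, show -x - (t - x / 2) = -x / 2 + -t by ring,
      show t - x / 2 = -x / 2 + t by ring, Real.exp_add, Real.exp_add]
    ring
  rw [h]
  ring_nf

theorem maternKernel_eq_besselIntegral {ν d : ℝ} (hν : 0 < ν) (hd : 0 < d) :
    maternKernel ν d = (Real.Gamma ν)⁻¹ * besselIntegral ν (-Real.log (ν * d ^ 2)) := by
  have hexp : Real.exp (-(-Real.log (ν * d ^ 2)) / 2) = √ν * d := by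
    rw [neg_neg, Real.log_mul hν.ne' (by positivity), Real.log_pow, add_div,
      Real.exp_add, ← Real.log_sqrt hν.le, Real.exp_log (by positivity)]
    push_cast
    rw [mul_div_cancel_left₀ _ two_ne_zero, Real.exp_log hd]
  have h := besselK_two_mul_exp ν (-Real.log (ν * d ^ 2))
  rw [hexp] at h
  have hpow : Real.exp (ν * -Real.log (ν * d ^ 2) / 2) * (√ν * d) ^ ν = 1 := by
    rw [← hexp, ← Real.exp_mul, ← Real.exp_add, Real.exp_eq_one_iff]
    ring
  rw [maternKernel, if_neg hd.ne', mul_assoc 2, h, Real.mul_rpow two_pos.le (by positivity),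
    Real.rpow_sub two_pos, Real.rpow_one]
  have h2 : (2 : ℝ) ^ ν ≠ 0 := by positivity
  calc _ = (Real.Gamma ν)⁻¹ * (Real.exp (ν * -Real.log (ν * d ^ 2) / 2) * (√ν * d) ^ ν) *
        besselIntegral ν (-Real.log (ν * d ^ 2)) := by field_simp
    _ = _ := by rw [hpow, mul_one]

/-- With `e^{-x} = ν d²`, the Bessel integral is the mean of `exp (-ν d² / t)` under the gamma law,
up to `Γ(ν)`: a Gaussian kernel of squared inverse length scale `ν / t`. -/
theorem isGaussianMixture_maternKernel {ν : ℝ} (hν : 0 < ν) :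
    IsGaussianMixture (maternKernel ν) := by
  have hprob := ProbabilityTheory.isProbabilityMeasure_gammaMeasure hν one_pos
  refine ⟨ProbabilityTheory.gammaMeasure ν 1, fun t => √(ν / t), hprob, by fun_prop,
    (ae_pos_gammaMeasure ν).mono fun t ht => Real.sqrt_pos.2 (div_pos hν ht), fun d hd => ?_⟩
  rcases hd.eq_or_lt with rfl | hd
  · simp [maternKernel]
  · rw [maternKernel_eq_besselIntegral hν hd, integral_gammaMeasure hν,
      ← integral_Ioi_rpow_mul_exp_eq_besselIntegral]
    congr 1
    refine setIntegral_congr_fun measurableSet_Ioi fun t ht => ?_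
    have ht' : (0 : ℝ) < t := ht
    simp only
    rw [neg_neg, Real.exp_log (by positivity), mul_pow, Real.sq_sqrt (by positivity),
      div_mul_eq_mul_div]

theorem squaredExponentialKernel_mem_expExpandable (d : ℝ) :
    (fun x => squaredExponentialKernel (d * Real.exp (-x))) ∈ expExpandable :=
  AnalyticAt.comp_exp_neg_mem_expExpandable (φ := fun ε => squaredExponentialKernel (d * ε)) (by
    unfold squaredExponentialKernel
    fun_prop)

theorem rationalQuadraticKernel_mem_expExpandable (ν d : ℝ) :
    (fun x => rationalQuadraticKernel ν (d * Real.exp (-x))) ∈ expExpandable :=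
  AnalyticAt.comp_exp_neg_mem_expExpandable (φ := fun ε => rationalQuadraticKernel ν (d * ε)) (by
    unfold rationalQuadraticKernel
    have h : AnalyticAt ℝ (fun ε : ℝ => (d * ε) ^ 2) 0 := by fun_prop
    have h1 : AnalyticAt ℝ (fun y : ℝ => (1 + y) ^ (-ν)) 0 :=
      Real.one_add_rpow_hasFPowerSeriesAt_zero.analyticAt
    exact h1.comp_of_eq h (by simp))

theorem maternKernel_mem_expExpandable {ν d : ℝ} (hν : 0 < ν) (hd : 0 ≤ d) :
    (fun x => maternKernel ν (d * Real.exp (-x))) ∈ expExpandable := by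
  rcases hd.eq_or_lt with rfl | hd
  · simpa [maternKernel] using const_mem_expExpandable 1
  · have h := expExpandable.smul_mem (expExpandable_comp_affine
      (besselIntegral_mem_expExpandable hν.le) one_le_two (-Real.log (ν * d ^ 2)))
      (Real.Gamma ν)⁻¹
    convert h using 1
    ext x
    rw [maternKernel_eq_besselIntegral hν (by positivity), Pi.smul_apply, smul_eq_mul, mul_pow,
      ← mul_assoc, Real.log_mul (by positivity) (by positivity), Real.log_pow, Real.log_exp]
    push_cast
    ring_nf

end Kernels

/-! ### Inverses, traces and adjugates. -/

section LinearAlgebra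

variable {m : Type*} [Fintype m] [DecidableEq m] {A : Matrix m m ℝ}

theorem inv_eq_of_posDef (hA : A.PosDef) :
    A⁻¹ = (hA.isHermitian.eigenvectorUnitary : Matrix m m ℝ) *
      diagonal (fun i => (hA.isHermitian.eigenvalues i)⁻¹) *
      star (hA.isHermitian.eigenvectorUnitary : Matrix m m ℝ) := by
  have hs : A = (hA.isHermitian.eigenvectorUnitary : Matrix m m ℝ) *
      diagonal hA.isHermitian.eigenvalues *
      star (hA.isHermitian.eigenvectorUnitary : Matrix m m ℝ) := by
    conv_lhs => rw [hA.isHermitian.spectral_theorem]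
    simp [Unitary.conjStarAlgAut_apply]
  set U := (hA.isHermitian.eigenvectorUnitary : Matrix m m ℝ) with hU
  have h1 : star U * U = 1 := Unitary.star_mul_self_of_mem hA.isHermitian.eigenvectorUnitary.2
  have h2 : U * star U = 1 := Unitary.mul_star_self_of_mem hA.isHermitian.eigenvectorUnitary.2
  refine inv_eq_right_inv ?_
  have h3 : diagonal hA.isHermitian.eigenvalues *
      diagonal (fun i => (hA.isHermitian.eigenvalues i)⁻¹) = 1 := by
    rw [diagonal_mul_diagonal, ← diagonal_one]
    congr 1
    ext i
    exact mul_inv_cancel₀ (hA.eigenvalues_pos i).ne'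
  refine (congrArg (· * _) hs).trans ?_
  calc _ = U * (diagonal hA.isHermitian.eigenvalues * (star U * U) *
        diagonal (fun i => (hA.isHermitian.eigenvalues i)⁻¹)) * star U := by
          simp only [Matrix.mul_assoc]
    _ = 1 := by rw [h1, Matrix.mul_one, h3, Matrix.mul_one, h2]

theorem trace_inv_eq_sum (hA : A.PosDef) :
    (A⁻¹).trace = ∑ i, (hA.isHermitian.eigenvalues i)⁻¹ := by
  rw [inv_eq_of_posDef hA, trace_mul_cycle,
    Unitary.star_mul_self_of_mem hA.isHermitian.eigenvectorUnitary.2, Matrix.one_mul,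
    trace_diagonal]

/-- Testing the form on `eᵢ ± eⱼ` gives `2 |A i j| ≤ A i i + A j j`. -/
theorem Matrix.PosSemidef.abs_apply_le_trace (hA : A.PosSemidef) (i j : m) :
    |A i j| ≤ A.trace := by
  have hsym : A j i = A i j := by simpa using hA.isHermitian.apply i j
  have hle : ∀ k, A k k ≤ A.trace := fun k =>
    Finset.single_le_sum (f := fun k => A k k) (fun k _ => hA.diag_nonneg) (Finset.mem_univ k)
  have hp := hA.dotProduct_mulVec_nonneg (Pi.single i 1 + Pi.single j 1)
  have hm := hA.dotProduct_mulVec_nonneg (Pi.single i 1 - Pi.single j 1)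
  simp only [star_trivial, mulVec_add, mulVec_sub, mulVec_single_one, add_dotProduct,
    sub_dotProduct, dotProduct_add, dotProduct_sub, single_one_dotProduct, col_apply, hsym]
    at hp hm
  rw [abs_le]
  constructor <;> linarith [hle i, hle j]

/-- Take `w = A u ≠ 0`. If the form vanishes at `z`, then `A z = 0`, so `z ⬝ᵥ A u = A z ⬝ᵥ u = 0`.
-/
theorem exists_hyperplane_normal (hA : A.PosSemidef) (h0 : A ≠ 0) :
    ∃ w : m → ℝ, w ≠ 0 ∧ ∀ z, z ⬝ᵥ w ≠ 0 → 0 < z ⬝ᵥ (A *ᵥ z) := by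
  obtain ⟨u, hu⟩ : ∃ u, A *ᵥ u ≠ 0 := by
    by_contra! h
    refine h0 (ext_of_mulVec_single fun i => ?_)
    rw [h, zero_mulVec]
  refine ⟨A *ᵥ u, hu, fun z hz => lt_of_le_of_ne (hA.dotProduct_mulVec_nonneg z) fun h => hz ?_⟩
  have h1 : A *ᵥ z = 0 := (hA.dotProduct_mulVec_zero_iff z).1 h.symm
  have h2 : Aᵀ = A := by
    simpa [conjTranspose_eq_transpose_of_trivial] using hA.isHermitian.eq
  rw [dotProduct_mulVec, ← mulVec_transpose, h2, h1, zero_dotProduct]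

theorem det_mem_of_entries_mem (S : Subalgebra ℝ (ℝ → ℝ)) {B : ℝ → Matrix m m ℝ}
    (hB : ∀ i j, (fun x => B x i j) ∈ S) : (fun x => (B x).det) ∈ S := by
  have h : (fun x => (B x).det) =
      ∑ σ : Equiv.Perm m, (Equiv.Perm.sign σ : ℤ) • ∏ i, fun x => B x (σ i) i := by
    ext x
    simp [det_apply, Finset.sum_apply, Finset.prod_apply, Units.smul_def]
  rw [h]
  exact S.sum_mem fun σ _ => S.toSubring.zsmul_mem (S.prod_mem fun i _ => hB _ _) _

/-- The algebra is not closed under division, so the argument runs on the adjugate, polynomial in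
the entries, in place of the inverse. -/
theorem adjugate_mem_of_entries_mem (S : Subalgebra ℝ (ℝ → ℝ)) {B : ℝ → Matrix m m ℝ}
    (hB : ∀ i j, (fun x => B x i j) ∈ S) (i j : m) : (fun x => (B x).adjugate i j) ∈ S := by
  simp only [adjugate_apply]
  refine det_mem_of_entries_mem S fun k l => ?_
  by_cases hk : k = j
  · subst hk
    simp only [updateRow_self]
    exact S.algebraMap_mem _
  · simp only [updateRow_ne hk]
    exact hB k l

end LinearAlgebra

/-! ### Limit of the normalized inverse and the exceptional hyperplane. -/

section ProjectedCorrelation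

variable {r n m : ℕ} {K : ℝ → ℝ} {x : Fin n → EuclideanSpace ℝ (Fin r)}
  {W : Matrix (Fin n) (Fin m) ℝ}

/-- Along `θ = eˣ`, all entries of the correlation matrices have expansions to all orders. -/
def HasExpandableEntries (K : ℝ → ℝ) : Prop :=
  ∀ d, 0 ≤ d → (fun x => K (d * Real.exp (-x))) ∈ expExpandable

theorem projCorrMatrix_mem_expExpandable (hK : HasExpandableEntries K)
    (x : Fin n → EuclideanSpace ℝ (Fin r)) (W : Matrix (Fin n) (Fin m) ℝ) (i j : Fin m) :
    (fun t => projCorrMatrix K x W (Real.exp t) i j) ∈ expExpandable := by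
  have h : (fun t => projCorrMatrix K x W (Real.exp t) i j) =
      ∑ l, ∑ k, (W k i * W l j) • fun t => K (‖x k - x l‖ * Real.exp (-t)) := by
    ext t
    simp only [projCorrMatrix, mul_apply, corrMatrix, transpose_apply, Matrix.of_apply,
      Finset.sum_apply, Pi.smul_apply, smul_eq_mul, Finset.sum_mul, Real.exp_neg, div_eq_mul_inv]
    exact Finset.sum_congr rfl fun l _ => Finset.sum_congr rfl fun k _ => by ring
  rw [h]
  exact expExpandable.sum_mem fun l _ => expExpandable.sum_mem fun k _ =>
    expExpandable.smul_mem (hK _ (norm_nonneg _)) _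

theorem mulVec_injective_of_transpose_mul_self (hW : Wᵀ * W = 1) :
    Function.Injective W.mulVec := fun u v huv => by
  have := congrArg (fun y => Wᵀ *ᵥ y) huv
  simpa [mulVec_mulVec, hW] using this

theorem IsGaussianMixture.posDef_projCorrMatrix (hK : IsGaussianMixture K)
    (hx : Function.Injective x) (hW : Wᵀ * W = 1) {θ : ℝ} (hθ : 0 < θ) :
    (projCorrMatrix K x W θ).PosDef := by
  have := (hK.posDef_corrMatrix hx hθ).conjTranspose_mul_mul_same
    (mulVec_injective_of_transpose_mul_self hW)
  rwa [conjTranspose_eq_transpose_of_trivial] at this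

theorem IsGaussianMixture.abs_le_one (hK : IsGaussianMixture K) {d : ℝ} (hd : 0 ≤ d) :
    |K d| ≤ 1 := by
  obtain ⟨μ, h, hμ, hh, -, hKd⟩ := hK
  rw [hKd d hd, abs_of_nonneg (integral_nonneg fun t => (Real.exp_pos _).le)]
  calc _ ≤ ∫ _t, (1 : ℝ) ∂μ := integral_mono (integrable_exp_neg_sq hh d) (integrable_const 1)
        fun t => Real.exp_le_one_iff.2 (neg_nonpos.2 (sq_nonneg _))
    _ = 1 := by simp

theorem IsGaussianMixture.exists_trace_le (hK : IsGaussianMixture K)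
    (x : Fin n → EuclideanSpace ℝ (Fin r)) (W : Matrix (Fin n) (Fin m) ℝ) :
    ∃ T : ℝ, 0 < T ∧ ∀ θ, 0 < θ → (projCorrMatrix K x W θ).trace ≤ T := by
  refine ⟨(∑ i, ∑ l, ∑ k, |W k i| * |W l i|) + 1, by positivity, fun θ hθ => ?_⟩
  refine le_trans ?_ (le_add_of_nonneg_right zero_le_one)
  simp only [Matrix.trace, diag_apply, projCorrMatrix, mul_apply, corrMatrix, transpose_apply,
    Matrix.of_apply, Finset.sum_mul]
  refine Finset.sum_le_sum fun i _ => Finset.sum_le_sum fun l _ => Finset.sum_le_sum fun k _ => ?_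
  refine (le_abs_self _).trans ?_
  rw [abs_mul, abs_mul]
  gcongr
  exact mul_le_of_le_one_right (abs_nonneg _) (hK.abs_le_one (by positivity))

theorem IsGaussianMixture.exists_le_eigenvalues (hK : IsGaussianMixture K)
    (hx : Function.Injective x) (hW : Wᵀ * W = 1) : ∃ c : ℝ, 0 < c ∧ ∃ N : ℕ,
      ∀ᶠ θ in atTop, ∀ i, c * θ⁻¹ ^ N ≤ projCorrEigenvalues K x W θ i := by
  obtain ⟨c, hc, N, h⟩ := hK.exists_le_quadForm hx
  refine ⟨c, hc, N, h.mono fun θ hθ => ?_⟩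
  refine le_eigenvalues_of_mul_dotProduct_self_le _ fun z => ?_
  have h1 := hθ (W *ᵥ z)
  have h2 : (W *ᵥ z) ⬝ᵥ (W *ᵥ z) = z ⬝ᵥ z := by
    rw [dotProduct_mulVec, ← mulVec_transpose, mulVec_mulVec, hW, one_mulVec]
  have h3 : (W *ᵥ z) ⬝ᵥ (corrMatrix K x θ *ᵥ (W *ᵥ z)) = z ⬝ᵥ (projCorrMatrix K x W θ *ᵥ z) := by
    rw [dotProduct_comm, dotProduct_mulVec, ← mulVec_transpose, dotProduct_comm, projCorrMatrix,
      ← mulVec_mulVec, ← mulVec_mulVec]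
  rwa [h2, h3] at h1

/-- `tr adj M = det M · tr M⁻¹`: the determinant is at least the `m`-th power of the eigenvalue
bound, and `tr M⁻¹ ≥ T⁻¹` since no eigenvalue exceeds `T`. -/
theorem IsGaussianMixture.exists_le_trace_adjugate (hK : IsGaussianMixture K)
    (hx : Function.Injective x) (hW : Wᵀ * W = 1) (hm : 0 < m) : ∃ c : ℝ, 0 < c ∧ ∃ N : ℕ,
      ∀ᶠ θ in atTop, c * θ⁻¹ ^ N ≤ (projCorrMatrix K x W θ).adjugate.trace := by
  obtain ⟨c, hc, N, h⟩ := hK.exists_le_eigenvalues hx hW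
  obtain ⟨T, hT, htr⟩ := hK.exists_trace_le x W
  refine ⟨c ^ m * T⁻¹, by positivity, N * m, ?_⟩
  filter_upwards [h, eventually_gt_atTop 0] with θ hθ hθ0
  have hpd := hK.posDef_projCorrMatrix hx hW hθ0
  have hadj : (projCorrMatrix K x W θ).adjugate =
      (projCorrMatrix K x W θ).det • (projCorrMatrix K x W θ)⁻¹ := by
    rw [Matrix.inv_def, smul_smul, Ring.mul_inverse_cancel _ hpd.det_pos.ne'.isUnit, one_smul]
  have hdet : (c * θ⁻¹ ^ N) ^ m ≤ (projCorrMatrix K x W θ).det := by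
    have h1 := hpd.isHermitian.det_eq_prod_eigenvalues
    simp only [RCLike.ofReal_real_eq_id, id] at h1
    rw [h1]
    calc _ = ∏ _i : Fin m, c * θ⁻¹ ^ N := by simp
      _ ≤ _ := Finset.prod_le_prod (fun i _ => by positivity) fun i _ => hθ i
  have htr' : T⁻¹ ≤ ((projCorrMatrix K x W θ)⁻¹).trace := by
    rw [trace_inv_eq_sum hpd]
    refine le_trans ?_ (Finset.single_le_sum (fun i _ => (inv_pos.2 (hpd.eigenvalues_pos i)).le)
      (Finset.mem_univ (⟨0, hm⟩ : Fin m)))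
    gcongr
    · exact hpd.eigenvalues_pos _
    · exact (hpd.eigenvalues_le_trace _).trans (htr θ hθ0)
  rw [hadj, trace_smul, smul_eq_mul, pow_mul, mul_right_comm, ← mul_pow]
  exact mul_le_mul hdet htr' (by positivity) hpd.det_pos.le

/-- The factor `det M` cancels, so the normalized inverse equals `adj M / tr adj M`, whose entries
are bounded quotients of expandable functions. The limit has trace one, hence is nonzero. -/
theorem exists_tendsto_inv_div_trace (hK : IsGaussianMixture K) (hE : HasExpandableEntries K)
    (hx : Function.Injective x) (hW : Wᵀ * W = 1) (hm : 0 < m) :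
    ∃ A : Matrix (Fin m) (Fin m) ℝ, A.PosSemidef ∧ A ≠ 0 ∧
      Tendsto (fun θ => ((projCorrMatrix K x W θ)⁻¹.trace)⁻¹ • (projCorrMatrix K x W θ)⁻¹)
        atTop (nhds A) := by
  have hne : Nonempty (Fin m) := ⟨⟨0, hm⟩⟩
  have hinv : ∀ θ, 0 < θ → (projCorrMatrix K x W θ)⁻¹.PosDef := fun θ hθ =>
    (hK.posDef_projCorrMatrix hx hW hθ).inv
  have hadj : ∀ θ, 0 < θ → (projCorrMatrix K x W θ).adjugate =
      (projCorrMatrix K x W θ).det • (projCorrMatrix K x W θ)⁻¹ := fun θ hθ => by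
    rw [Matrix.inv_def, smul_smul, Ring.mul_inverse_cancel _
      (hK.posDef_projCorrMatrix hx hW hθ).det_pos.ne'.isUnit, one_smul]
  obtain ⟨c, hc, N, hlow⟩ := hK.exists_le_trace_adjugate hx hW hm
  have hmem := adjugate_mem_of_entries_mem expExpandable (projCorrMatrix_mem_expExpandable hE x W)
  have htrmem : (fun t => (projCorrMatrix K x W (Real.exp t)).adjugate.trace) ∈ expExpandable := by
    have : (fun t => (projCorrMatrix K x W (Real.exp t)).adjugate.trace) =
        ∑ i, fun t => (projCorrMatrix K x W (Real.exp t)).adjugate i i := by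
      ext t; simp [Matrix.trace]
    rw [this]
    exact expExpandable.sum_mem fun i _ => hmem i i
  have hN : (fun t => Real.exp (-(N : ℝ) * t)) =O[atTop]
      fun t => (projCorrMatrix K x W (Real.exp t)).adjugate.trace := by
    refine IsBigO.of_bound c⁻¹ ((Real.tendsto_exp_atTop.eventually hlow).mono fun t ht => ?_)
    rw [← Real.exp_neg, ← Real.exp_nat_mul, mul_neg, ← neg_mul] at ht
    rw [Real.norm_eq_abs, Real.abs_exp, inv_mul_eq_div, le_div_iff₀ hc, mul_comm]
    exact ht.trans (le_abs_self _)
  have hO : ∀ i j, (fun t => (projCorrMatrix K x W (Real.exp t)).adjugate i j) =O[atTop]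
      fun t => (projCorrMatrix K x W (Real.exp t)).adjugate.trace := fun i j => by
    refine IsBigO.of_bound 1 (Eventually.of_forall fun t => ?_)
    have hpd := hK.posDef_projCorrMatrix hx hW (Real.exp_pos t)
    have hps : (projCorrMatrix K x W (Real.exp t)).adjugate.PosSemidef := by
      rw [hadj _ (Real.exp_pos t)]
      exact hpd.inv.posSemidef.smul hpd.det_pos.le
    rw [one_mul]
    exact (hps.abs_apply_le_trace i j).trans (le_abs_self _)
  have hlim := fun i j => exists_tendsto_div_of_mem_expExpandable (hmem i j) htrmem hN (hO i j)
  choose l hl using hlim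
  have hT : Tendsto (fun θ => ((projCorrMatrix K x W θ)⁻¹.trace)⁻¹ • (projCorrMatrix K x W θ)⁻¹)
      atTop (nhds (Matrix.of l)) := by
    refine tendsto_pi_nhds.2 fun i => tendsto_pi_nhds.2 fun j => ?_
    refine ((hl i j).comp Real.tendsto_log_atTop).congr' ?_
    filter_upwards [eventually_gt_atTop 0] with θ hθ
    have hd := (hK.posDef_projCorrMatrix hx hW hθ).det_pos.ne'
    simp only [Function.comp_apply, Real.exp_log hθ, hadj θ hθ, trace_smul, Matrix.smul_apply,
      smul_eq_mul]
    rw [mul_div_mul_left _ _ hd, div_eq_inv_mul]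
  have hquad : ∀ z : Fin m → ℝ, Tendsto (fun θ => z ⬝ᵥ ((((projCorrMatrix K x W θ)⁻¹.trace)⁻¹ •
      (projCorrMatrix K x W θ)⁻¹) *ᵥ z)) atTop (nhds (z ⬝ᵥ (Matrix.of l *ᵥ z))) := fun z => by
    have hc : Continuous fun B : Matrix (Fin m) (Fin m) ℝ => z ⬝ᵥ (B *ᵥ z) := by fun_prop
    exact (hc.tendsto _).comp hT
  refine ⟨Matrix.of l, ?_, ?_, hT⟩
  · refine PosSemidef.of_dotProduct_mulVec_nonneg ?_ fun z => ?_
    · ext i j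
      rw [conjTranspose_apply, star_trivial]
      have hc : ∀ i j, Continuous fun B : Matrix (Fin m) (Fin m) ℝ => B i j := fun i j => by
        fun_prop
      have h1 := ((hc j i).tendsto _).comp hT
      have h2 := ((hc i j).tendsto _).comp hT
      refine tendsto_nhds_unique (h1.congr' ?_) h2
      filter_upwards [eventually_gt_atTop 0] with θ hθ
      simp only [Function.comp_apply, Matrix.smul_apply]
      rw [← (hinv θ hθ).isHermitian.apply i j, star_trivial]
    · refine ge_of_tendsto (hquad z) ?_
      filter_upwards [eventually_gt_atTop 0] with θ hθ
      exact ((hinv θ hθ).posSemidef.smul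
        (inv_nonneg.2 (hinv θ hθ).trace_pos.le)).dotProduct_mulVec_nonneg z
  · intro h0
    have hc : Continuous fun B : Matrix (Fin m) (Fin m) ℝ => B.trace := by fun_prop
    have h1 := (hc.tendsto _).comp hT
    rw [h0, trace_zero] at h1
    refine zero_ne_one (tendsto_nhds_unique h1 (tendsto_const_nhds.congr' ?_))
    filter_upwards [eventually_gt_atTop 0] with θ hθ
    rw [Function.comp_apply, trace_smul, smul_eq_mul, inv_mul_cancel₀ (hinv θ hθ).trace_pos.ne']

theorem exists_eq_projCorrMinEigenvalue (hm : 0 < m) (K : ℝ → ℝ)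
    (x : Fin n → EuclideanSpace ℝ (Fin r)) (W : Matrix (Fin n) (Fin m) ℝ) (θ : ℝ) :
    ∃ i, projCorrEigenvalues K x W θ i = projCorrMinEigenvalue K x W θ := by
  have : Nonempty (Fin m) := ⟨⟨0, hm⟩⟩
  exact exists_eq_ciInf_of_finite

theorem projCorrMinEigenvalue_le (K : ℝ → ℝ) (x : Fin n → EuclideanSpace ℝ (Fin r))
    (W : Matrix (Fin n) (Fin m) ℝ) (θ : ℝ) (i : Fin m) :
    projCorrMinEigenvalue K x W θ ≤ projCorrEigenvalues K x W θ i :=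
  ciInf_le (Set.finite_range _).bddBelow i

/-- Outside a hyperplane, the quadratic form `yᵀ W (Wᵀ Σ_θ W)⁻¹ Wᵀ y` grows at least like the
inverse of the smallest eigenvalue of `Wᵀ Σ_θ W`. -/
theorem exists_hyperplane_inv_projQuadForm_le (hK : IsGaussianMixture K)
    (hE : HasExpandableEntries K) (hx : Function.Injective x) (hW : Wᵀ * W = 1) (hm : 0 < m) :
    ∃ 𝓗 : Submodule ℝ (Fin n → ℝ), Module.finrank ℝ 𝓗 + 1 = n ∧ ∀ y, y ∉ 𝓗 →
      (∀ θ, 0 < θ → 0 < projQuadForm K x W y θ) ∧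
      ∃ C, 0 < C ∧ ∀ᶠ θ in atTop,
        (projQuadForm K x W y θ)⁻¹ ≤ C * projCorrMinEigenvalue K x W θ := by
  have hne : Nonempty (Fin m) := ⟨⟨0, hm⟩⟩
  obtain ⟨A, hA, hA0, hT⟩ := exists_tendsto_inv_div_trace hK hE hx hW hm
  obtain ⟨w, hw, hz⟩ := exists_hyperplane_normal hA hA0
  -- The hyperplane is the orthogonal of `W w`, nonzero because `Wᵀ W = 1`.
  let φ : Module.Dual ℝ (Fin n → ℝ) := dotProductBilin ℝ ℝ (W *ᵥ w)
  have hφ : ∀ y, φ y = (Wᵀ *ᵥ y) ⬝ᵥ w := fun y => by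
    change (W *ᵥ w) ⬝ᵥ y = _
    rw [dotProduct_comm, dotProduct_mulVec, mulVec_transpose]
  have hφ0 : φ ≠ 0 := fun h => hw <| by
    have := hφ (W *ᵥ w)
    rw [h, LinearMap.zero_apply, mulVec_mulVec, hW, one_mulVec] at this
    exact dotProduct_self_eq_zero.1 this.symm
  refine ⟨LinearMap.ker φ, ?_, fun y hy => ?_⟩
  · rw [Module.Dual.finrank_ker_add_one_of_ne_zero hφ0, Module.finrank_fin_fun]
  rw [LinearMap.mem_ker, hφ] at hy
  have hy0 : Wᵀ *ᵥ y ≠ 0 := fun h => hy (by rw [h, zero_dotProduct])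
  have hpos := hz _ hy
  refine ⟨fun θ hθ => (hK.posDef_projCorrMatrix hx hW hθ).inv.dotProduct_mulVec_pos hy0, ?_⟩
  set q := (Wᵀ *ᵥ y) ⬝ᵥ (A *ᵥ (Wᵀ *ᵥ y)) with hq
  -- The normalized form tends to `q > 0`, so it eventually exceeds `q / 2`.
  refine ⟨2 / q, by positivity, ?_⟩
  have hc : Continuous fun B : Matrix (Fin m) (Fin m) ℝ => (Wᵀ *ᵥ y) ⬝ᵥ (B *ᵥ (Wᵀ *ᵥ y)) := by
    fun_prop
  have hlim := ((hc.tendsto _).comp hT).eventually_const_lt (half_lt_self hpos)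
  filter_upwards [hlim, eventually_gt_atTop 0] with θ h1 hθ
  have hpd := hK.posDef_projCorrMatrix hx hW hθ
  have htr := hpd.inv.trace_pos
  rw [Function.comp_apply, smul_mulVec, dotProduct_smul, smul_eq_mul, inv_mul_eq_div,
    lt_div_iff₀ htr] at h1
  obtain ⟨i, hi⟩ := exists_eq_projCorrMinEigenvalue hm K x W θ
  have hv : 0 < projCorrMinEigenvalue K x W θ := hi ▸ hpd.eigenvalues_pos i
  have h2 : (projCorrMinEigenvalue K x W θ)⁻¹ ≤ (projCorrMatrix K x W θ)⁻¹.trace := by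
    rw [trace_inv_eq_sum hpd, ← hi]
    exact Finset.single_le_sum (f := fun i => (hpd.isHermitian.eigenvalues i)⁻¹)
      (fun i _ => (inv_pos.2 (hpd.eigenvalues_pos i)).le) (Finset.mem_univ i)
  have h3 : q / 2 * (projCorrMinEigenvalue K x W θ)⁻¹ ≤ projQuadForm K x W y θ :=
    (mul_le_mul_of_nonneg_left h2 (by positivity)).trans h1.le
  refine (inv_anti₀ (by positivity) h3).trans (le_of_eq ?_)
  rw [mul_inv, inv_inv, inv_div]

end ProjectedCorrelation

/-! ### Block diagonalization and completion of the square. -/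

section BlockIdentities

variable {n p m : Type*} [Fintype n] {S : Matrix n n ℝ} {H : Matrix n p ℝ} {W : Matrix n m ℝ}

theorem posDef_transpose_mul_mul [Fintype m] [DecidableEq m] (hS : S.PosDef) (hW : Wᵀ * W = 1) :
    (Wᵀ * S * W).PosDef := by
  have hinj : Function.Injective W.mulVec := fun u v huv => by
    have := congrArg (fun y => Wᵀ *ᵥ y) huv
    simpa [mulVec_mulVec, hW] using this
  have := hS.conjTranspose_mul_mul_same hinj
  rwa [conjTranspose_eq_transpose_of_trivial] at this

variable [DecidableEq n]

theorem transpose_fromCols_mul_mul_fromCols (hS : S.PosDef) (hHW : Hᵀ * W = 0) :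
    (fromCols (S⁻¹ * H) W)ᵀ * S * fromCols (S⁻¹ * H) W =
      fromBlocks (Hᵀ * S⁻¹ * H) 0 0 (Wᵀ * S * W) := by
  have hdet := hS.det_pos.ne'.isUnit
  have hSt : (S⁻¹)ᵀ = S⁻¹ := by
    simpa [conjTranspose_eq_transpose_of_trivial] using hS.inv.isHermitian.eq
  have hWH : Wᵀ * H = 0 := by
    rw [← transpose_transpose H, ← transpose_mul, hHW, transpose_zero]
  rw [transpose_fromCols, fromRows_mul, fromRows_mul_fromCols, transpose_mul, hSt,
    Matrix.mul_assoc Hᵀ, nonsing_inv_mul _ hdet, Matrix.mul_one, hHW, Matrix.mul_assoc Wᵀ,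
    mul_nonsing_inv_cancel_left _ _ hdet, hWH, Matrix.mul_assoc Hᵀ]

variable [Fintype p]

theorem posDef_transpose_mul_inv_mul (hS : S.PosDef) (hH : Function.Injective H.mulVec) :
    (Hᵀ * S⁻¹ * H).PosDef := by
  have := hS.inv.conjTranspose_mul_mul_same hH
  rwa [conjTranspose_eq_transpose_of_trivial] at this

variable [Fintype m] [DecidableEq p] [DecidableEq m]

/-- The square matrix `T = [S⁻¹ H | W]` block-diagonalizes `S`, so `S⁻¹ = T (Tᵀ S T)⁻¹ Tᵀ`. -/
theorem inv_eq_add_of_posDef (e : n ≃ p ⊕ m) (hS : S.PosDef) (hH : Function.Injective H.mulVec)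
    (hW : Wᵀ * W = 1) (hHW : Hᵀ * W = 0) :
    S⁻¹ = S⁻¹ * H * (Hᵀ * S⁻¹ * H)⁻¹ * (Hᵀ * S⁻¹) + W * (Wᵀ * S * W)⁻¹ * Wᵀ := by
  set A := Hᵀ * S⁻¹ * H with hA
  set M := Wᵀ * S * W with hM
  have hAu := (posDef_transpose_mul_inv_mul hS hH).det_pos.ne'.isUnit
  have hMu := (posDef_transpose_mul_mul hS hW).det_pos.ne'.isUnit
  have hSt : (S⁻¹)ᵀ = S⁻¹ := by
    simpa [conjTranspose_eq_transpose_of_trivial] using hS.inv.isHermitian.eq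
  set T := fromCols (S⁻¹ * H) W
  have h1 : Tᵀ * (S * T * fromBlocks A⁻¹ 0 0 M⁻¹) = 1 := by
    rw [← Matrix.mul_assoc, ← Matrix.mul_assoc, transpose_fromCols_mul_mul_fromCols hS hHW,
      fromBlocks_multiply]
    simp [← hA, ← hM, mul_nonsing_inv A hAu, mul_nonsing_inv M hMu]
  rw [mul_eq_one_comm_of_equiv e.symm] at h1
  refine (inv_eq_right_inv (B := T * fromBlocks A⁻¹ 0 0 M⁻¹ * Tᵀ) ?_).trans ?_
  · rw [← h1]
    simp only [Matrix.mul_assoc]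
  · rw [fromCols_mul_fromBlocks, transpose_fromCols, fromCols_mul_fromRows, transpose_mul, hSt]
    simp

theorem det_mul_det_eq (e : n ≃ p ⊕ m) (hS : S.PosDef) (hH : Function.Injective H.mulVec)
    (hW : Wᵀ * W = 1) (hHW : Hᵀ * W = 0) :
    S.det * (Hᵀ * S⁻¹ * H).det = (Hᵀ * H).det * (Wᵀ * S * W).det := by
  have hWH : Wᵀ * H = 0 := by
    rw [← transpose_transpose H, ← transpose_mul, hHW, transpose_zero]
  have hA := (posDef_transpose_mul_inv_mul hS hH).det_pos
  set T := fromCols (S⁻¹ * H) W with hT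
  set P := fromCols H W with hP
  have hTS := transpose_fromCols_mul_mul_fromCols hS hHW
  have hPT : Pᵀ * T = fromBlocks (Hᵀ * S⁻¹ * H) 0 (Wᵀ * (S⁻¹ * H)) 1 := by
    rw [hP, hT, transpose_fromCols, fromRows_mul_fromCols, hHW, hW, Matrix.mul_assoc]
  have hPP : Pᵀ * P = fromBlocks (Hᵀ * H) 0 0 1 := by
    rw [hP, transpose_fromCols, fromRows_mul_fromCols, hHW, hW, hWH]
  have hsub : ∀ (X Y : Matrix n (p ⊕ m) ℝ), (Xᵀ * Y).det =
      (X.submatrix id e).det * (Y.submatrix id e).det := fun X Y => by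
    rw [← det_submatrix_equiv_self e, ← det_transpose (X.submatrix id e), ← det_mul,
      transpose_submatrix, submatrix_mul _ _ e id e Function.bijective_id]
  have e1 : (T.submatrix id e).det * (S.det * (T.submatrix id e).det) =
      (Hᵀ * S⁻¹ * H).det * (Wᵀ * S * W).det := by
    have h := hsub T (S * T)
    rw [← Matrix.mul_assoc, hTS, det_fromBlocks_zero₂₁,
      submatrix_mul S T id id e Function.bijective_id, submatrix_id_id, det_mul] at h
    exact h.symm
  have e2 := hsub P T
  rw [hPT, det_fromBlocks_zero₁₂, det_one, mul_one] at e2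
  have e3 := hsub P P
  rw [hPP, det_fromBlocks_zero₁₂, det_one, mul_one] at e3
  -- With `P = [H | W]`, comparing the determinants of `Pᵀ T`, `Pᵀ P` and `Tᵀ S T` gives the
  -- identity multiplied by `det (Hᵀ S⁻¹ H)`.
  refine mul_right_cancel₀ hA.ne' ?_
  calc _ = S.det * (Hᵀ * S⁻¹ * H).det ^ 2 := by ring
    _ = (P.submatrix id e).det * (P.submatrix id e).det *
        ((T.submatrix id e).det * (S.det * (T.submatrix id e).det)) := by rw [e2]; ring
    _ = _ := by rw [e1, ← e3]; ring

/-- Completing the square in the exponent of the Gaussian likelihood. -/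
theorem exists_quadForm_sub_mulVec_eq (e : n ≃ p ⊕ m) (hS : S.PosDef)
    (hH : Function.Injective H.mulVec) (hW : Wᵀ * W = 1) (hHW : Hᵀ * W = 0) (y : n → ℝ) :
    ∃ β₀ : p → ℝ, ∀ β, (y - H *ᵥ β) ⬝ᵥ (S⁻¹ *ᵥ (y - H *ᵥ β)) =
      (Wᵀ *ᵥ y) ⬝ᵥ ((Wᵀ * S * W)⁻¹ *ᵥ (Wᵀ *ᵥ y)) +
        (β - β₀) ⬝ᵥ ((Hᵀ * S⁻¹ * H) *ᵥ (β - β₀)) := by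
  have hWH : Wᵀ * H = 0 := by
    rw [← transpose_transpose H, ← transpose_mul, hHW, transpose_zero]
  have hSt : (S⁻¹)ᵀ = S⁻¹ := by
    simpa [conjTranspose_eq_transpose_of_trivial] using hS.inv.isHermitian.eq
  have hinv := inv_eq_add_of_posDef e hS hH hW hHW
  have hAu := (posDef_transpose_mul_inv_mul hS hH).det_pos.ne'.isUnit
  set A := Hᵀ * S⁻¹ * H with hA
  set M := Wᵀ * S * W with hM
  -- The generalized least squares estimator of `β`.
  refine ⟨A⁻¹ *ᵥ ((Hᵀ * S⁻¹) *ᵥ y), fun β => ?_⟩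
  set β₀ := A⁻¹ *ᵥ ((Hᵀ * S⁻¹) *ᵥ y) with hβ₀
  have h1 : (Hᵀ * S⁻¹) *ᵥ (y - H *ᵥ β) = -(A *ᵥ (β - β₀)) := by
    rw [mulVec_sub, mulVec_sub, mulVec_mulVec, hβ₀, mulVec_mulVec, mul_nonsing_inv _ hAu,
      one_mulVec, ← hA, neg_sub]
  have h2 : Wᵀ *ᵥ (y - H *ᵥ β) = Wᵀ *ᵥ y := by
    rw [mulVec_sub, mulVec_mulVec, hWH, zero_mulVec, sub_zero]
  have h3 : S⁻¹ * H = (Hᵀ * S⁻¹)ᵀ := by rw [transpose_mul, hSt, transpose_transpose]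
  rw [hinv, add_mulVec, dotProduct_add, add_comm]
  congr 1
  · rw [← mulVec_mulVec, ← mulVec_mulVec, h2, dotProduct_mulVec, ← mulVec_transpose, h2]
  · rw [← mulVec_mulVec, ← mulVec_mulVec, h1, dotProduct_mulVec, ← mulVec_transpose, h3,
      transpose_transpose, h1, mulVec_neg, neg_dotProduct, dotProduct_neg, neg_neg, mulVec_mulVec,
      nonsing_inv_mul _ hAu, one_mulVec, dotProduct_comm]

end BlockIdentities

/-! ### Integrals over the mean parameters and the variance. -/

section GaussianIntegrals

open scoped MatrixOrder in
theorem exists_eq_transpose_mul_self {p : Type*} [Fintype p] [DecidableEq p] {A : Matrix p p ℝ}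
    (hA : A.PosSemidef) : ∃ B : Matrix p p ℝ, A = Bᵀ * B := by
  obtain ⟨B, hB⟩ := CStarAlgebra.nonneg_iff_eq_star_mul_self.mp hA.nonneg
  rw [star_eq_conjTranspose, conjTranspose_eq_transpose_of_trivial] at hB
  exact ⟨B, hB⟩

theorem lintegral_comp_mulVec {p : Type*} [Fintype p] [DecidableEq p] {B : Matrix p p ℝ}
    (hB : B.det ≠ 0) {f : (p → ℝ) → ENNReal} (hf : Measurable f) :
    ∫⁻ β, f (B *ᵥ β) = ENNReal.ofReal |B.det|⁻¹ * ∫⁻ γ, f γ := by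
  have h := lintegral_map (μ := volume) hf (toLin' B).continuous_of_finiteDimensional.measurable
  rw [Real.map_matrix_volume_pi_eq_smul_volume_pi hB, lintegral_smul_measure, abs_inv] at h
  simpa using h.symm

theorem lintegral_exp_neg_half_dotProduct_ne_top (p : Type*) [Fintype p] :
    ∫⁻ γ : p → ℝ, ENNReal.ofReal (Real.exp (-(1 / 2) * (γ ⬝ᵥ γ))) ≠ ⊤ := by
  have h : Integrable fun γ : p → ℝ => ∏ i, Real.exp (-(1 / 2) * γ i ^ 2) :=
    Integrable.fintype_prod (f := fun _ t => Real.exp (-(1 / 2) * t ^ 2))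
      fun _ => integrable_exp_neg_mul_sq (by norm_num)
  have heq : (fun γ : p → ℝ => ∏ i, Real.exp (-(1 / 2) * γ i ^ 2)) =
      fun γ => Real.exp (-(1 / 2) * (γ ⬝ᵥ γ)) := by
    ext γ
    rw [← Real.exp_sum, ← Finset.mul_sum, dotProduct]
    simp only [sq]
  rw [heq] at h
  exact h.lintegral_lt_top.ne

/-- Factor `A = Bᵀ B` and substitute `γ = s^{-1/2} B (β - β₀)`. -/
theorem lintegral_exp_neg_quadForm {p : Type*} [Fintype p] [DecidableEq p] {A : Matrix p p ℝ}
    (hA : A.PosDef) {s : ℝ} (hs : 0 < s) (β₀ : p → ℝ) :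
    ∫⁻ β : p → ℝ, ENNReal.ofReal (Real.exp (-(1 / (2 * s)) * ((β - β₀) ⬝ᵥ (A *ᵥ (β - β₀))))) =
      ENNReal.ofReal (s ^ ((Fintype.card p : ℝ) / 2) * A.det ^ (-(1 / 2) : ℝ)) *
        ∫⁻ γ : p → ℝ, ENNReal.ofReal (Real.exp (-(1 / 2) * (γ ⬝ᵥ γ))) := by
  obtain ⟨B, hBA⟩ := exists_eq_transpose_mul_self hA.posSemidef
  have hdet : A.det = B.det ^ 2 := by rw [hBA, det_mul, det_transpose, sq]
  have hB : B.det ≠ 0 := fun h => hA.det_pos.ne' (by rw [hdet, h, sq, mul_zero])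
  rw [lintegral_sub_right_eq_self (fun β : p → ℝ =>
    ENNReal.ofReal (Real.exp (-(1 / (2 * s)) * (β ⬝ᵥ (A *ᵥ β))))) β₀]
  have hsq : 0 < √s := Real.sqrt_pos.2 hs
  have hdet' : ((√s)⁻¹ • B).det ≠ 0 := by
    rw [det_smul]
    positivity
  have hf : Measurable fun γ : p → ℝ => ENNReal.ofReal (Real.exp (-(1 / 2) * (γ ⬝ᵥ γ))) := by
    unfold dotProduct
    fun_prop
  have h := lintegral_comp_mulVec hdet' hf
  have hint : ∀ β : p → ℝ, (((√s)⁻¹ • B) *ᵥ β) ⬝ᵥ (((√s)⁻¹ • B) *ᵥ β) =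
      s⁻¹ * (β ⬝ᵥ (A *ᵥ β)) := fun β => by
    rw [smul_mulVec, smul_dotProduct, dotProduct_smul, smul_smul, hBA, ← mulVec_mulVec,
      dotProduct_mulVec β, ← mulVec_transpose, transpose_transpose, smul_eq_mul, ← mul_inv,
      Real.mul_self_sqrt hs.le]
  have hcoef : |((√s)⁻¹ • B).det|⁻¹ =
      s ^ ((Fintype.card p : ℝ) / 2) * A.det ^ (-(1 / 2) : ℝ) := by
    rw [det_smul, hdet, Real.rpow_neg (by positivity), ← Real.sqrt_eq_rpow, Real.sqrt_sq_eq_abs,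
      abs_mul, mul_inv, abs_of_pos (by positivity), inv_pow, inv_inv, Real.sqrt_eq_rpow,
      ← Real.rpow_natCast, ← Real.rpow_mul hs.le]
    ring_nf
  rw [← hcoef, ← h]
  congr 1
  ext β
  rw [hint]
  congr 2
  field_simp

/-- The substitution `s = q / (2u)` turns this into the integral defining `Γ(k)`. -/
theorem lintegral_rpow_mul_exp_neg_div {k q : ℝ} (hk : 0 < k) (hq : 0 < q) :
    ∫⁻ s in Set.Ioi (0 : ℝ), ENNReal.ofReal (s ^ (-k - 1) * Real.exp (-(1 / (2 * s)) * q)) =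
      ENNReal.ofReal (2 ^ k * Real.Gamma k * q ^ (-k)) := by
  have himg : (fun u : ℝ => q / (2 * u)) '' Set.Ioi 0 = Set.Ioi 0 := by
    ext s
    constructor
    · rintro ⟨u, hu, rfl⟩
      have : (0 : ℝ) < u := hu
      exact Set.mem_Ioi.2 (by positivity)
    · intro hs
      have : (0 : ℝ) < s := hs
      refine ⟨q / (2 * s), Set.mem_Ioi.2 (by positivity), ?_⟩
      field_simp
  have hinj : Set.InjOn (fun u : ℝ => q / (2 * u)) (Set.Ioi 0) := by
    intro u hu v hv huv
    have hu' : (0 : ℝ) < u := hu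
    have hv' : (0 : ℝ) < v := hv
    simp only at huv
    field_simp at huv
    linarith
  have hd : ∀ u ∈ Set.Ioi (0 : ℝ), HasDerivWithinAt (fun u : ℝ => q / (2 * u))
      (-(q / (2 * u ^ 2))) (Set.Ioi 0) u := by
    intro u hu
    have hu' : (0 : ℝ) < u := hu
    have h := ((hasDerivAt_inv hu'.ne').const_mul (q / 2)).hasDerivWithinAt (s := Set.Ioi 0)
    have he : (fun u : ℝ => q / (2 * u)) = fun u => q / 2 * u⁻¹ := by
      ext v
      rw [div_mul_eq_div_div, div_eq_mul_inv (q / 2)]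
    rw [he]
    refine h.congr_deriv ?_
    field_simp
  have h := lintegral_image_eq_lintegral_abs_deriv_mul measurableSet_Ioi hd hinj
    fun s => ENNReal.ofReal (s ^ (-k - 1) * Real.exp (-(1 / (2 * s)) * q))
  rw [himg] at h
  have hG : ∫⁻ u in Set.Ioi (0 : ℝ), ENNReal.ofReal (Real.exp (-u) * u ^ (k - 1)) =
      ENNReal.ofReal (Real.Gamma k) := by
    rw [Real.Gamma_eq_integral hk, ofReal_integral_eq_lintegral_ofReal
      (Real.GammaIntegral_convergent hk)]
    filter_upwards [self_mem_ae_restrict measurableSet_Ioi] with u hu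
    have hu' : (0 : ℝ) < u := hu
    simp only [Pi.zero_apply]
    positivity
  rw [h, mul_right_comm, ENNReal.ofReal_mul (by positivity), ← hG,
    ← lintegral_const_mul' _ _ ENNReal.ofReal_ne_top]
  refine setLIntegral_congr_fun measurableSet_Ioi fun u hu => ?_
  have hu' : (0 : ℝ) < u := hu
  rw [← ENNReal.ofReal_mul (abs_nonneg _), ← ENNReal.ofReal_mul (by positivity), abs_neg,
    abs_of_pos (by positivity)]
  congr 1
  have e1 : -(1 / (2 * (q / (2 * u)))) * q = -u := by field_simp
  have e2 : (q / (2 * u)) ^ (-k - 1) = 2 ^ k * q ^ (-k) * u ^ (k - 1) * (2 * u ^ 2 / q) := by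
    rw [Real.div_rpow hq.le (by positivity), Real.mul_rpow two_pos.le hu'.le,
      Real.rpow_sub hq, Real.rpow_sub two_pos, Real.rpow_sub hu', Real.rpow_sub hu',
      Real.rpow_neg two_pos.le, Real.rpow_neg hu'.le, Real.rpow_one, Real.rpow_one, Real.rpow_one]
    field_simp
  rw [e1, e2]
  field_simp

end GaussianIntegrals

/-! ### Closed form of the integrated likelihood. -/

section IntegratedLikelihood

variable {n p m : ℕ} {H : Matrix (Fin n) (Fin p) ℝ}
  {W : Matrix (Fin n) (Fin m) ℝ}

/-- Closed form of the integrated likelihood, up to a constant depending only on `H`. -/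
theorem exists_integratedLikelihood_eq (hn : p + m = n) (hm : 0 < m)
    (hH : Function.Injective H.mulVec) (hW : Wᵀ * W = 1) (hHW : Hᵀ * W = 0) :
    ∃ C : ℝ, 0 ≤ C ∧ ∀ (S : Matrix (Fin n) (Fin n) ℝ), S.PosDef → ∀ y : Fin n → ℝ,
      0 < (Wᵀ *ᵥ y) ⬝ᵥ ((Wᵀ * S * W)⁻¹ *ᵥ (Wᵀ *ᵥ y)) →
      integratedLikelihood S H y = ENNReal.ofReal (C * ((Wᵀ * S * W).det ^ (-(1 / 2) : ℝ) *
        ((Wᵀ *ᵥ y) ⬝ᵥ ((Wᵀ * S * W)⁻¹ *ᵥ (Wᵀ *ᵥ y))) ^ (-((m : ℝ) / 2)))) := by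
  have e : Fin n ≃ Fin p ⊕ Fin m := ((finSumFinEquiv).trans (finCongr hn)).symm
  have hm' : (0 : ℝ) < m := by exact_mod_cast hm
  -- Only the finiteness of this Gaussian constant matters, not its value.
  set c := ∫⁻ γ : Fin p → ℝ, ENNReal.ofReal (Real.exp (-(1 / 2) * (γ ⬝ᵥ γ))) with hc
  have hctop : c ≠ ⊤ := lintegral_exp_neg_half_dotProduct_ne_top (Fin p)
  have hG : 0 < (Hᵀ * H).det := by
    have := (PosDef.one (n := Fin n) (R := ℝ)).conjTranspose_mul_mul_same hH
    rw [Matrix.mul_one, conjTranspose_eq_transpose_of_trivial] at this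
    exact this.det_pos
  refine ⟨(1 / (2 * Real.pi)) ^ ((n : ℝ) / 2) * (Hᵀ * H).det ^ (-(1 / 2) : ℝ) * c.toReal *
    (2 ^ ((m : ℝ) / 2) * Real.Gamma ((m : ℝ) / 2)),
    mul_nonneg (by positivity) (by have := Real.Gamma_pos_of_pos (half_pos hm'); positivity),
    fun S hS y hQ => ?_⟩
  obtain ⟨β₀, hβ₀⟩ := exists_quadForm_sub_mulVec_eq e hS hH hW hHW y
  have hdets := det_mul_det_eq e hS hH hW hHW
  have hA := posDef_transpose_mul_inv_mul hS hH
  have hM := (posDef_transpose_mul_mul hS hW).det_pos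
  set Q := (Wᵀ *ᵥ y) ⬝ᵥ ((Wᵀ * S * W)⁻¹ *ᵥ (Wᵀ *ᵥ y))
  set A := Hᵀ * S⁻¹ * H
  have hSd := hS.det_pos
  have hAd := hA.det_pos
  set κ := (1 / (2 * Real.pi)) ^ ((n : ℝ) / 2) * (Hᵀ * H).det ^ (-(1 / 2) : ℝ) *
    (Wᵀ * S * W).det ^ (-(1 / 2) : ℝ) with hκ
  have hinner : ∀ s ∈ Set.Ioi (0 : ℝ),
      ∫⁻ β : Fin p → ℝ, ENNReal.ofReal (gaussianLikelihood S H y β s / s) =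
        ENNReal.ofReal κ * c *
          ENNReal.ofReal (s ^ (-((m : ℝ) / 2) - 1) * Real.exp (-(1 / (2 * s)) * Q)) := by
    intro s hs
    have hs' : (0 : ℝ) < s := hs
    have h1 : ∀ β, ENNReal.ofReal (gaussianLikelihood S H y β s / s) =
        ENNReal.ofReal ((1 / (2 * Real.pi * s)) ^ ((n : ℝ) / 2) * S.det ^ (-(1 / 2) : ℝ) *
          Real.exp (-(1 / (2 * s)) * Q) / s) *
        ENNReal.ofReal (Real.exp (-(1 / (2 * s)) * ((β - β₀) ⬝ᵥ (A *ᵥ (β - β₀))))) := by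
      intro β
      rw [← ENNReal.ofReal_mul (by positivity), gaussianLikelihood, hβ₀, mul_add, Real.exp_add]
      congr 1
      ring
    simp only [h1]
    rw [lintegral_const_mul' _ _ ENNReal.ofReal_ne_top, lintegral_exp_neg_quadForm hA hs',
      ← hc, ← mul_assoc, ← ENNReal.ofReal_mul (by positivity), mul_right_comm (ENNReal.ofReal κ) c,
      ← ENNReal.ofReal_mul (by positivity)]
    congr 2
    have e1 : S.det ^ (-(1 / 2) : ℝ) * A.det ^ (-(1 / 2) : ℝ) =
        (Hᵀ * H).det ^ (-(1 / 2) : ℝ) * (Wᵀ * S * W).det ^ (-(1 / 2) : ℝ) := by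
      rw [← Real.mul_rpow hSd.le hAd.le, hdets, Real.mul_rpow hG.le hM.le]
    -- Integrating out `β` contributes `s^{p/2}`; with `s^{-n/2}` and the prior `1 / s` this leaves
    -- `s^{-m/2 - 1}`.
    have e2 : (1 / (2 * Real.pi * s)) ^ ((n : ℝ) / 2) * s ^ ((p : ℝ) / 2) / s =
        (1 / (2 * Real.pi)) ^ ((n : ℝ) / 2) * s ^ (-((m : ℝ) / 2) - 1) := by
      have hns : (1 / (2 * Real.pi * s)) = 1 / (2 * Real.pi) * s⁻¹ := by field_simp
      rw [hns, Real.mul_rpow (by positivity) (by positivity), Real.inv_rpow hs'.le,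
        ← Real.rpow_neg hs'.le, mul_assoc, mul_div_assoc, ← Real.rpow_add hs', Real.rpow_sub hs',
        Real.rpow_one]
      congr 3
      rw [← hn]
      push_cast
      ring
    rw [Fintype.card_fin]
    calc _ = ((1 / (2 * Real.pi * s)) ^ ((n : ℝ) / 2) * s ^ ((p : ℝ) / 2) / s) *
          (S.det ^ (-(1 / 2) : ℝ) * A.det ^ (-(1 / 2) : ℝ)) *
          Real.exp (-(1 / (2 * s)) * Q) := by ring
      _ = _ := by rw [e1, e2, hκ]; ring
  rw [integratedLikelihood, setLIntegral_congr_fun measurableSet_Ioi hinner,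
    lintegral_const_mul' _ _ (ENNReal.mul_ne_top ENNReal.ofReal_ne_top hctop),
    lintegral_rpow_mul_exp_neg_div (half_pos hm') hQ]
  have hΓ := Real.Gamma_pos_of_pos (half_pos hm')
  conv_lhs => rw [← ENNReal.ofReal_toReal hctop]
  rw [← ENNReal.ofReal_mul (by positivity), ← ENNReal.ofReal_mul (by positivity)]
  congr 1
  rw [hκ]
  ring

end IntegratedLikelihood

/-! ### The main theorem. -/

section Main

theorem mulVec_injective_of_rank_eq {n p : ℕ} {H : Matrix (Fin n) (Fin p) ℝ} (h : H.rank = p) :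
    Function.Injective H.mulVec := by
  have h1 := H.mulVecLin.finrank_range_add_finrank_ker
  rw [← Matrix.rank, h, Module.finrank_fin_fun] at h1
  have h2 : LinearMap.ker H.mulVecLin = ⊥ := Submodule.finrank_eq_zero.1 (by omega)
  exact LinearMap.ker_eq_bot.1 h2

theorem isGaussianMixture_and_hasExpandableEntries {K : ℝ → ℝ}
    (hK : K = squaredExponentialKernel ∨ (∃ ν : ℝ, 0 < ν ∧ K = rationalQuadraticKernel ν) ∨
      (∃ ν : ℝ, 1 ≤ ν ∧ K = maternKernel ν)) :
    IsGaussianMixture K ∧ HasExpandableEntries K := by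
  rcases hK with rfl | ⟨ν, hν, rfl⟩ | ⟨ν, hν, rfl⟩
  · exact ⟨isGaussianMixture_squaredExponentialKernel,
      fun d _ => squaredExponentialKernel_mem_expExpandable d⟩
  · exact ⟨isGaussianMixture_rationalQuadraticKernel hν,
      fun d _ => rationalQuadraticKernel_mem_expExpandable ν d⟩
  · exact ⟨isGaussianMixture_maternKernel (by linarith),
      fun d hd => maternKernel_mem_expExpandable (by linarith) hd⟩

/-- The square is `q⁻ᵐ / ∏ vᵢ`; one factor `q⁻¹ ≤ b` is assigned to each `vᵢ`. -/
theorem rpow_det_mul_rpow_sq_le {m : ℕ} {v : Fin m → ℝ} (hv : ∀ i, 0 < v i) {q b : ℝ} (hq : 0 < q)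
    (hb : q⁻¹ ≤ b) :
    ((∏ i, v i) ^ (-(1 / 2) : ℝ) * q ^ (-((m : ℝ) / 2))) ^ 2 ≤ ∏ i, b / v i := by
  have hp : 0 < ∏ i, v i := Finset.prod_pos fun i _ => hv i
  have e1 : ((∏ i, v i) ^ (-(1 / 2) : ℝ)) ^ 2 = (∏ i, v i)⁻¹ := by
    rw [← Real.rpow_natCast, ← Real.rpow_mul hp.le, ← Real.rpow_neg_one]
    norm_num
  have e2 : (q ^ (-((m : ℝ) / 2))) ^ 2 = q⁻¹ ^ m := by
    rw [← Real.rpow_natCast, ← Real.rpow_mul hq.le, ← Real.rpow_natCast, Real.inv_rpow hq.le,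
      ← Real.rpow_neg hq.le]
    congr 1
    push_cast
    ring
  rw [mul_pow, e1, e2, Finset.prod_div_distrib, Finset.prod_const, Finset.card_univ,
    Fintype.card_fin, inv_mul_eq_div]
  gcongr

theorem mainTheorem3 {r n p : ℕ} (hr : 0 < r) (hpn : p < n)
    (K : ℝ → ℝ)
    (hK : K = squaredExponentialKernel ∨ (∃ ν : ℝ, 0 < ν ∧ K = rationalQuadraticKernel ν) ∨
      (∃ ν : ℝ, 1 ≤ ν ∧ K = maternKernel ν))
    (𝒟 : Set (EuclideanSpace ℝ (Fin r))) (x : Fin n → 𝒟) (hx : Function.Injective x)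
    (f : Fin p → 𝒟 → ℝ) (hf : (trendMatrix f x).rank = p)
    (W : Matrix (Fin n) (Fin (n - p)) ℝ) (hW : Wᵀ * W = 1) (hHW : (trendMatrix f x)ᵀ * W = 0) :
    ∃ 𝓗 : Submodule ℝ (Fin n → ℝ), Module.finrank ℝ 𝓗 + 1 = n ∧
      ∀ y : Fin n → ℝ, y ∉ 𝓗 →
        (∀ θ : ℝ, 0 < θ → 0 < projQuadForm K (fun i => (x i : EuclideanSpace ℝ (Fin r))) W y θ) ∧
        ((fun θ : ℝ => (projQuadForm K (fun i => (x i : EuclideanSpace ℝ (Fin r))) W y θ)⁻¹)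
          =O[atTop]
          fun θ : ℝ => projCorrMinEigenvalue K (fun i => (x i : EuclideanSpace ℝ (Fin r))) W θ) ∧
        (∀ θ : ℝ, 0 < θ →
          integratedLikelihood (corrMatrix K (fun i => (x i : EuclideanSpace ℝ (Fin r))) θ)
            (trendMatrix f x) y ≠ ⊤) ∧
        ((fun θ : ℝ => (integratedLikelihood
            (corrMatrix K (fun i => (x i : EuclideanSpace ℝ (Fin r))) θ)
            (trendMatrix f x) y).toReal ^ 2)
          =O[atTop]
          fun θ : ℝ => ∏ i : Fin (n - p),
            projCorrMinEigenvalue K (fun i => (x i : EuclideanSpace ℝ (Fin r))) W θ /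
              projCorrEigenvalues K (fun i => (x i : EuclideanSpace ℝ (Fin r))) W θ i) ∧
        ((fun θ : ℝ => (integratedLikelihood
            (corrMatrix K (fun i => (x i : EuclideanSpace ℝ (Fin r))) θ)
            (trendMatrix f x) y).toReal)
          =O[atTop] fun _ : ℝ => (1 : ℝ)) := by
  obtain ⟨hmix, hexp⟩ := isGaussianMixture_and_hasExpandableEntries hK
  have hm : 0 < n - p := Nat.sub_pos_of_lt hpn
  have hinj : Function.Injective fun i => (x i : EuclideanSpace ℝ (Fin r)) :=
    Subtype.val_injective.comp hx
  set X := fun i => (x i : EuclideanSpace ℝ (Fin r))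
  obtain ⟨𝓗, hdim, h𝓗⟩ := exists_hyperplane_inv_projQuadForm_le hmix hexp hinj hW hm
  obtain ⟨C, hC, hL⟩ := exists_integratedLikelihood_eq (by omega) hm
    (mulVec_injective_of_rank_eq hf) hW hHW
  refine ⟨𝓗, hdim, fun y hy => ?_⟩
  obtain ⟨hpos, D, hD, hbound⟩ := h𝓗 y hy
  have hLθ : ∀ θ, 0 < θ → integratedLikelihood (corrMatrix K X θ) (trendMatrix f x) y =
      ENNReal.ofReal (C * ((projCorrMatrix K X W θ).det ^ (-(1 / 2) : ℝ) *
        projQuadForm K X W y θ ^ (-(((n - p : ℕ) : ℝ) / 2)))) := fun θ hθ =>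
    hL _ (hmix.posDef_corrMatrix hinj hθ) y (hpos θ hθ)
  have hsq : ∀ᶠ θ in atTop, (∀ i, 0 < projCorrEigenvalues K X W θ i) ∧
      (integratedLikelihood (corrMatrix K X θ) (trendMatrix f x) y).toReal ^ 2 ≤
        C ^ 2 * D ^ (n - p) * ∏ i, projCorrMinEigenvalue K X W θ / projCorrEigenvalues K X W θ i := by
    filter_upwards [hbound, eventually_gt_atTop 0] with θ hθ hθ0
    have hpd := hmix.posDef_projCorrMatrix hinj hW hθ0
    have hv : ∀ i, 0 < projCorrEigenvalues K X W θ i := fun i => hpd.eigenvalues_pos i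
    have hdet := hpd.isHermitian.det_eq_prod_eigenvalues
    simp only [RCLike.ofReal_real_eq_id, id] at hdet
    have hd := hpd.det_pos
    have hq := hpos θ hθ0
    have h := rpow_det_mul_rpow_sq_le hv hq hθ
    refine ⟨hv, ?_⟩
    rw [hLθ θ hθ0, ENNReal.toReal_ofReal (by positivity), mul_pow, hdet, mul_assoc]
    refine mul_le_mul_of_nonneg_left (h.trans (le_of_eq ?_)) (sq_nonneg C)
    simp only [mul_div_assoc]
    rw [Finset.prod_mul_distrib, Finset.prod_const, Finset.card_univ, Fintype.card_fin]
  have hmin : ∀ θ, (∀ i, 0 < projCorrEigenvalues K X W θ i) →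
      0 < projCorrMinEigenvalue K X W θ := fun θ hv => by
    obtain ⟨i, hi⟩ := exists_eq_projCorrMinEigenvalue hm K X W θ
    exact hi ▸ hv i
  refine ⟨hpos, ?_, fun θ hθ => by rw [hLθ θ hθ]; exact ENNReal.ofReal_ne_top, ?_, ?_⟩
  · refine IsBigO.of_bound D ?_
    filter_upwards [hbound, eventually_gt_atTop 0] with θ hθ hθ0
    rw [Real.norm_of_nonneg (inv_nonneg.2 (hpos θ hθ0).le)]
    exact hθ.trans (mul_le_mul_of_nonneg_left (le_abs_self _) hD.le)
  · refine IsBigO.of_bound (C ^ 2 * D ^ (n - p)) (hsq.mono fun θ hθ => ?_)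
    rw [Real.norm_of_nonneg (sq_nonneg _)]
    exact hθ.2.trans (mul_le_mul_of_nonneg_left (le_abs_self _) (by positivity))
  · refine IsBigO.of_bound (√(C ^ 2 * D ^ (n - p))) (hsq.mono fun θ hθ => ?_)
    rw [norm_one, mul_one, Real.norm_of_nonneg ENNReal.toReal_nonneg]
    -- Boundedness follows from the bound on `L²`, as each factor of the product is at most one.
    refine Real.le_sqrt_of_sq_le (hθ.2.trans (mul_le_of_le_one_right (by positivity) ?_))
    refine Finset.prod_le_one (fun i _ => (div_pos (hmin θ hθ.1) (hθ.1 i)).le) fun i _ => ?_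
    exact (div_le_one (hθ.1 i)).2 (projCorrMinEigenvalue_le K X W θ i)

end Main
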